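/- Let $n\in\mathbb{N}=\{0,1,2,\dots\}$ and $[n]=\{1,\dots,n\}$. Let $\mathcal{PB}_n$ be the partial Brauer monoid: the partitions of $[n]\cup[n]'$ into blocks of size at most $2$, with the usual product of partition diagrams. For $\alpha\in\mathcal{PB}_n$ let $\operatorname{rank}(\alpha)$ be the number of blocks of $\alpha$ meeting both $[n]$ and $[n]'$, and let $\ker(\alpha)$ (respectively $\operatorname{coker}(\alpha)$) be the equivalence on $[n]$ relating $x,y$ whenever $x,y$ (respectively $x',y'$) lie in the same block of $\alpha$. A PB-pair on a set $T$ is a pair $(\varepsilon,X)$, where $\varepsilon$ is an equivalence on $T$ all of whose classes have size at most $2$, and $X\subseteq T$ is such that each element of $X$ forms a singleton $\varepsilon$-class. The rank of the join $(\varepsilon_1,X_1)\vee(\varepsilon_2,X_2)$ of two PB-pairs is the number of pairs $(x,y)\in X_1\times X_2$ with $x,y$ in the same class of $\varepsilon_1\vee\varepsilon_2$. For $0\le k\le m$ with $k\equiv m\pmod 2$, let $\varepsilon_{m,k}$ be the equivalence on $[m]$ with classes $\{1\},\dots,\{k\},\{k+1,k+2\},\dots,\{m-1,m\}$. For $m,k,t,q\in\mathbb{N}$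 let $\mu(m,k,t,q)$ be the number of PB-pairs $(\eta,X)$ on $[m]$ such that $|X|=q$ and $(\varepsilon_{m,k},[t])\vee(\eta,X)$ has rank $q$; put $\mu(m,k,t,q)=0$ if $\varepsilon_{m,k}$ is undefined or $(\varepsilon_{m,k},[t])$ is not a PB-pair on $[m]$. Let $\alpha\in\mathcal{PB}_n$ and $r=\operatorname{rank}(\alpha)$. Let $\mathcal{PB}_n^\alpha$ be the variant of $\mathcal{PB}_n$, i.e. the semigroup on the set $\mathcal{PB}_n$ with operation $\xi\star_\alpha\sigma=\xi\alpha\sigma$; let $\mathscr{L}^\alpha$, $\mathscr{R}^\alpha$, $\mathscr{D}^\alpha$ be its Green's relations, and $\mathscr{L}$, $\mathscr{R}$ those of $\mathcal{PB}_n$. For $0\le q\le r$ put $$D_q^\alpha=\{\xi\in\mathcal{PB}_n:\ \xi\alpha\mathrel{\mathscr{R}}\xi,\ \alpha\xi\mathrel{\mathscr{L}}\xi,\ \operatorname{rank}(\xi)=q\}.$$ Then, for every $0\le q\le r$: 1. $D_q^\alpha$ is a $\mathscr{D}^\alpha$-class of $\mathcal{PB}_n^\alpha$ consisting of regular elements;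 2. $|D_q^\alpha/\mathscr{L}^\alpha|=\mu(n,k,r,q)$, where $k$ is the number of singleton classes of $\ker(\alpha)$; 3. $|D_q^\alpha/\mathscr{R}^\alpha|=\mu(n,l,r,q)$, where $l$ is the number of singleton classes of $\operatorname{coker}(\alpha)$. -/

import Mathlib

namespace PartialBrauer

/-! ### Green's relations, regular elements and variants of a semigroup -/

section Green

variable {S : Type*} [Semigroup S]

/-- The principal left ideal `S¹x = {x} ∪ Sx`. -/
def leftIdeal (x : S) : Set S := insert x {z | ∃ s, z = s * x}

/-- The principal right ideal `xS¹ = {x} ∪ xS`. -/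
def rightIdeal (x : S) : Set S := insert x {z | ∃ s, z = x * s}

/-- Green's relation `L`: `S¹x = S¹y`. -/
def greenL (S : Type*) [Semigroup S] : Setoid S := Setoid.ker leftIdeal

/-- Green's relation `R`: `xS¹ = yS¹`. -/
def greenR (S : Type*) [Semigroup S] : Setoid S := Setoid.ker rightIdeal

/-- Green's relation `D = R ∘ L`. -/
def GreenD (x y : S) : Prop := ∃ z, greenR S x z ∧ greenL S z y

/-- `x` is a regular element of the semigroup `S`. -/
def IsRegularElt (x : S) : Prop := ∃ y, x = x * y * x ∧ y = y * x * y

end Green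

/-- `C` is a `D`-class of `S` all of whose elements are regular. -/
def IsRegularDClass (S : Type*) [Semigroup S] (C : Set S) : Prop :=
  (∃ x, C = {y | GreenD x y}) ∧ ∀ x ∈ C, IsRegularElt x

/-- The number `|A / r|` of classes of the restriction to `A` of the equivalence relation `r`. -/
noncomputable def numClasses {S : Type*} (r : Setoid S) (A : Set S) : ℕ :=
  Nat.card (Quotient (Setoid.comap (Subtype.val : A → S) r))

/-- The underlying set of the variant `S^a` is that of `S`. -/
def Variant {S : Type*} (_a : S) : Type _ := S

/-- The sandwich operation `x ⋆ y = x a y`. -/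
def sandwich {S : Type*} [Semigroup S] (a x y : S) : S := x * a * y

theorem sandwich_assoc {S : Type*} [Semigroup S] (a x y z : S) :
    sandwich a (sandwich a x y) z = sandwich a x (sandwich a y z) := by
  simp only [sandwich, mul_assoc]

/-- The variant `S^a`, the semigroup with the sandwich operation. -/
instance Variant.semigroup {S : Type*} [Semigroup S] (a : S) : Semigroup (Variant a) where
  mul := @sandwich S _ a
  mul_assoc := @sandwich_assoc S _ a

/-- The P-set `P^a = {x : x a R x and a x L x}`, with Green's relations `R` and `L` of `S`. -/
def pSet {S : Type*} [Semigroup S] (a : S) : Set S :=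
  {x | greenR S (x * a) x ∧ greenL S (a * x) x}

/-! ### 1-2-equivalences -/

/-- Every class has at most two elements. -/
def IsOneTwo {T : Type*} (ε : Setoid T) : Prop := ∀ C ∈ ε.classes, C.encard ≤ 2

theorem isOneTwo_iff {T : Type*} {ε : Setoid T} :
    IsOneTwo ε ↔ ∀ x y z, ε x y → ε x z → x = y ∨ x = z ∨ y = z := by
  constructor
  · intro h x y z hxy hxz
    by_contra! hne
    have h3 : ({x, y, z} : Set T).encard = 3 :=
      Set.encard_eq_three.2 ⟨x, y, z, hne.1, hne.2.1, hne.2.2, rfl⟩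
    have hsub : ({x, y, z} : Set T) ⊆ {w | ε w x} := by
      rintro w (rfl | rfl | rfl)
      · exact ε.refl _
      · exact ε.symm hxy
      · exact ε.symm hxz
    have := (Set.encard_le_encard hsub).trans (h _ (ε.mem_classes x))
    rw [h3] at this
    exact absurd this (by decide)
  · rintro h C ⟨x, rfl⟩
    by_contra! hlt
    obtain ⟨t, ht, htc⟩ := Set.exists_subset_encard_eq (Order.add_one_le_of_lt hlt)
    obtain ⟨u, v, w, huv, huw, hvw, rfl⟩ := Set.encard_eq_three.1 (htc.trans (by rfl))
    have hu : ε u x := ht (by simp)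
    have hv : ε v x := ht (by simp)
    have hw : ε w x := ht (by simp)
    rcases h u v w (ε.trans hu (ε.symm hv)) (ε.trans hu (ε.symm hw)) with h | h | h
    exacts [huv h, huw h, hvw h]

/-! ### Auxiliary facts on equivalences, needed for the product of diagrams -/

theorem map_le_iff {V W : Type*} {r : Setoid V} {f : V → W} {s : Setoid W} :
    r.map f ≤ s ↔ r ≤ s.comap f := by
  constructor
  · exact fun h x y hxy => h (Setoid.le_comap_map hxy)
  · intro h
    refine Setoid.eqvGen_le ?_
    rintro _ _ ⟨x, y, hxy, rfl, rfl⟩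
    exact h hxy

theorem map_sup {V W : Type*} (r s : Setoid V) (f : V → W) :
    (r ⊔ s).map f = r.map f ⊔ s.map f :=
  eq_of_forall_ge_iff fun t => by simp only [map_le_iff, sup_le_iff]

theorem map_map {U V W : Type*} (r : Setoid U) (f : U → V) (g : V → W) :
    (r.map f).map g = r.map (g ∘ f) :=
  eq_of_forall_ge_iff fun t => by simp only [map_le_iff, Setoid.comap_comp]

theorem map_rel {V W : Type*} {r : Setoid V} {f : V → W} (hf : f.Injective) {u v : W} :
    r.map f u v ↔ (∃ x y, r x y ∧ f x = u ∧ f y = v) ∨ u = v := by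
  rw [Setoid.coe_map_of_ker_le r f (Setoid.ker_eq_bot_iff.2 hf ▸ bot_le)]
  rfl

theorem isOneTwo_map {V W : Type*} {r : Setoid V} (hr : IsOneTwo r) {f : V → W}
    (hf : f.Injective) : IsOneTwo (r.map f) := by
  rw [isOneTwo_iff] at hr ⊢
  intro x y z hxy hxz
  rw [map_rel hf] at hxy hxz
  rcases hxy with ⟨a, b, hab, rfl, rfl⟩ | h
  · rcases hxz with ⟨a', c, hac, haa, rfl⟩ | h
    · cases hf haa
      simpa only [hf.eq_iff] using hr a b c hab hac
    · exact Or.inr (Or.inl h)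
  · exact Or.inl h

theorem comap_sup_map {V W : Type*} (S : Setoid W) (G : Setoid V) (i : V → W) :
    (S ⊔ G.map i).comap i = S.comap i ⊔ G := by
  apply le_antisymm
  · let T := S.comap i ⊔ G
    let R : Setoid W :=
      { r := fun u v => S u v ∨ ∃ a b, S u (i a) ∧ T a b ∧ S (i b) v
        iseqv := by
          refine ⟨fun u => Or.inl (S.refl u), ?_, ?_⟩
          · rintro u v (h | ⟨a, b, h1, h2, h3⟩)
            · exact Or.inl (S.symm h)
            · exact Or.inr ⟨b, a, S.symm h3, T.symm h2, S.symm h1⟩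
          · rintro u v w (h | ⟨a, b, h1, h2, h3⟩) (h' | ⟨a', b', h1', h2', h3'⟩)
            · exact Or.inl (S.trans h h')
            · exact Or.inr ⟨a', b', S.trans h h1', h2', h3'⟩
            · exact Or.inr ⟨a, b, h1, h2, S.trans h3 h'⟩
            · have hm : T b a' := (le_sup_left : S.comap i ≤ T) (S.trans h3 h1')
              exact Or.inr ⟨a, b', h1, T.trans h2 (T.trans hm h2'), h3'⟩ }
    have hR : S ⊔ G.map i ≤ R := by
      refine sup_le (fun _ _ h => Or.inl h) (map_le_iff.2 fun a b h => Or.inr ⟨a, b, ?_⟩)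
      exact ⟨S.refl _, (le_sup_right : G ≤ T) h, S.refl _⟩
    intro a b hab
    rcases hR hab with h | ⟨c, d, h1, h2, h3⟩
    · exact (le_sup_left : S.comap i ≤ T) h
    · have hl : S.comap i ≤ T := le_sup_left
      exact T.trans (hl h1) (T.trans h2 (hl h3))
  · refine sup_le (fun a b h => (le_sup_left : S ≤ S ⊔ G.map i) h) ?_
    exact map_le_iff.1 le_sup_right

theorem comap_map_square {U V V' W : Type*} (X : Setoid V') {i : V → W} {j : V' → W}
    {f : U → V} {o : U → V'} (hi : i.Injective) (hj : j.Injective) (hf : f.Injective)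
    (hc : i ∘ f = j ∘ o) (hp : ∀ v x, i v = j x → ∃ u, f u = v ∧ o u = x) :
    (X.map j).comap i = (X.comap o).map f := by
  apply le_antisymm
  · intro a b hab
    rw [map_rel hf]
    rcases (map_rel hj).1 hab with ⟨x, y, hxy, hx, hy⟩ | h
    · obtain ⟨u, rfl, rfl⟩ := hp a x hx.symm
      obtain ⟨v, rfl, rfl⟩ := hp b y hy.symm
      exact Or.inl ⟨u, v, hxy, rfl, rfl⟩
    · exact Or.inr (hi h)
  · rw [map_le_iff]
    change _ ≤ (X.map j).comap (i ∘ f)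
    rw [hc]
    exact fun a b h => Setoid.le_comap_map h

/-- If two 1-2-equivalences are given, and each element of `O` lies in a singleton class of one of
them, then each class of their join contains at most two elements of `O`. -/
theorem isOneTwo_comap_sup {V T : Type*} {A B : Setoid V} (hA : IsOneTwo A) (hB : IsOneTwo B)
    {o : T → V} (ho : o.Injective)
    (hO : ∀ t, (∀ w, A (o t) w → w = o t) ∨ ∀ w, B (o t) w → w = o t) :
    IsOneTwo ((A ⊔ B).comap o) := by
  rw [isOneTwo_iff] at hA hB ⊢
  -- States of a walk: a vertex and the equivalence (`true` for `A`) to be used next.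
  let E : Bool → Setoid V := fun s => if s then A else B
  have hE : ∀ s x y z, E s x y → E s x z → x = y ∨ x = z ∨ y = z := by
    intro s; cases s
    · exact hB
    · exact hA
  let step : V × Bool → V × Bool → Prop := fun p p' => p'.1 ≠ p.1 ∧ p'.2 = !p.2 ∧ E p.2 p.1 p'.1
  have hdet : Relator.RightUnique step := by
    rintro ⟨u, s⟩ ⟨v, _⟩ ⟨w, _⟩ ⟨h1, rfl, h3⟩ ⟨h1', rfl, h3'⟩
    rcases hE s u v w h3 h3' with h | h | h
    · exact absurd h.symm h1
    · exact absurd h.symm h1'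
    · exact Prod.ext h rfl
  have hO' : ∀ t, ∃ s, ∀ w, E (!s) (o t) w → w = o t := by
    intro t
    rcases hO t with h | h
    · exact ⟨false, h⟩
    · exact ⟨true, h⟩
  intro x y z hxy hxz
  obtain ⟨s, hs⟩ := hO' x
  let reach : V × Bool → Prop := Relation.ReflTransGen step (o x, s)
  -- The visited vertices are closed under both equivalences.
  have hclosed : ∀ c v w, (∃ s', reach (v, s')) → E c v w → ∃ s', reach (w, s') := by
    rintro c v w ⟨s', hv⟩ hvw
    by_cases hwv : w = v
    · exact ⟨s', hwv ▸ hv⟩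
    by_cases hc : c = s'
    · subst hc
      exact ⟨!c, hv.tail ⟨hwv, rfl, hvw⟩⟩
    · have hc' : c = !s' := Bool.eq_not_of_ne hc
      subst hc'
      rcases Relation.ReflTransGen.cases_tail hv with h | ⟨⟨u, s''⟩, hu, h1, h2, h3⟩
      · cases h
        exact absurd (hs w hvw) hwv
      · simp only at h1 h2 h3
        have : s'' = !s' := by rw [h2, Bool.not_not]
        subst this
        rcases hE _ v u w ((E _).symm h3) hvw with h | h | h
        · exact absurd h h1
        · exact absurd h.symm hwv
        · exact ⟨_, h ▸ hu⟩
  have hclass : ∀ w, (A ⊔ B) (o x) w → ∃ s', reach (w, s') := by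
    let R : Setoid V :=
      { r := fun u v => (∃ s', reach (u, s')) ↔ ∃ s', reach (v, s')
        iseqv := ⟨fun _ => Iff.rfl, Iff.symm, Iff.trans⟩ }
    have hR : A ⊔ B ≤ R :=
      sup_le (fun u v h => ⟨fun hu => hclosed true u v hu h,
          fun hv => hclosed true v u hv (A.symm h)⟩)
        (fun u v h => ⟨fun hu => hclosed false u v hu h,
          fun hv => hclosed false v u hv (B.symm h)⟩)
    exact fun w hw => (hR hw).1 ⟨s, Relation.ReflTransGen.refl⟩
  -- A visited element of `O` other than the first one is the end of the walk.
  have hterm : ∀ t, t ≠ x → ∀ s', reach (o t, s') → ∀ p, Relation.ReflTransGen step (o t, s') p →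
      p = (o t, s') := by
    intro t ht s' hr p hp
    rcases Relation.ReflTransGen.cases_tail hr with h | ⟨⟨u, s''⟩, -, h1, h2, h3⟩
    · exact absurd (ho (congrArg Prod.fst h)) ht
    · simp only at h1 h2 h3
      obtain ⟨d, hd⟩ := hO' t
      have hds : d ≠ s' := by
        rintro rfl
        have h4 : s'' = !d := by rw [h2, Bool.not_not]
        subst h4
        exact h1 (hd u ((E _).symm h3)).symm
      have hds' : s' = !d := Bool.eq_not_of_ne (Ne.symm hds)
      rcases Relation.ReflTransGen.cases_head hp with h | ⟨⟨w, c⟩, ⟨h1', -, h3'⟩, -⟩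
      · exact h.symm
      · subst hds'
        exact absurd (hd w h3') h1'
  by_cases hxy' : x = y
  · exact Or.inl hxy'
  by_cases hxz' : x = z
  · exact Or.inr (Or.inl hxz')
  obtain ⟨sy, hy⟩ := hclass _ hxy
  obtain ⟨sz, hz⟩ := hclass _ hxz
  rcases Relation.ReflTransGen.total_of_right_unique hdet hy hz with h | h
  · exact Or.inr (Or.inr (ho (congrArg Prod.fst (hterm y (Ne.symm hxy') sy hy _ h)).symm))
  · exact Or.inr (Or.inr (ho (congrArg Prod.fst (hterm z (Ne.symm hxz') sz hz _ h))))

/-! ### The partial Brauer monoid -/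

/-- `PB n` is the set of partitions of `[n] ∪ [n]'` into blocks of size at most two. The elements
of `[n]` are `Sum.inl i`, those of `[n]'` are `Sum.inr i`, with `i : Fin n`. -/
@[ext]
structure PB (n : ℕ) where
  part : Setoid (Fin n ⊕ Fin n)
  isOneTwo : IsOneTwo part

/-- The vertices of a diagram with `m` rows of `n` vertices: place the upper row of a partition
in row `a` and the lower one in row `b`. -/
def rows {n m : ℕ} (a b : Fin m) : Fin n ⊕ Fin n → Fin m × Fin n :=
  Sum.elim (fun i => (a, i)) (fun i => (b, i))

theorem rows_injective {n m : ℕ} {a b : Fin m} (h : a ≠ b) :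
    (rows a b : Fin n ⊕ Fin n → Fin m × Fin n).Injective := by
  rintro (i | i) (j | j) hij <;> simp_all [rows]

/-- The connectedness relation of the product diagram `Π(α, β)` with rows `0, 1, 2`: the diagram
of `α` is drawn on rows `0, 1`, that of `β` on rows `1, 2`. -/
def productDiagram {n : ℕ} (α β : Setoid (Fin n ⊕ Fin n)) : Setoid (Fin 3 × Fin n) :=
  α.map (rows 0 1) ⊔ β.map (rows 1 2)

/-- The product: two outer vertices are in the same block iff they are connected in the product
diagram. -/
def productPart {n : ℕ} (α β : Setoid (Fin n ⊕ Fin n)) : Setoid (Fin n ⊕ Fin n) :=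
  (productDiagram α β).comap (rows 0 2)

theorem isOneTwo_productPart {n : ℕ} {α β : Setoid (Fin n ⊕ Fin n)} (hα : IsOneTwo α)
    (hβ : IsOneTwo β) : IsOneTwo (productPart α β) := by
  refine isOneTwo_comap_sup (isOneTwo_map hα (rows_injective (by decide)))
    (isOneTwo_map hβ (rows_injective (by decide))) (rows_injective (by decide)) ?_
  rintro (i | i)
  · right
    intro w hw
    rcases (map_rel (rows_injective (by decide))).1 hw with ⟨x | x, y, -, hx, -⟩ | h
    · simp [rows] at hx
    · simp [rows] at hx
    · exact h.symm
  · left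
    intro w hw
    rcases (map_rel (rows_injective (by decide))).1 hw with ⟨x | x, y, -, hx, -⟩ | h
    · simp [rows] at hx
    · simp [rows] at hx
    · exact h.symm

theorem map_rows {n m p : ℕ} (h : Fin m → Fin p) (a b : Fin m) :
    Prod.map h id ∘ (rows a b : Fin n ⊕ Fin n → _) = rows (h a) (h b) := by
  funext x
  rcases x with x | x <;> rfl

theorem productPart_assoc {n : ℕ} (α β γ : Setoid (Fin n ⊕ Fin n)) :
    productPart (productPart α β) γ = productPart α (productPart β γ) := by
  have inj : ∀ h : Fin 3 → Fin 4, h.Injective →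
      (Prod.map h id : Fin 3 × Fin n → Fin 4 × Fin n).Injective :=
    fun h hh => hh.prodMap Function.injective_id
  have hl : productPart (productPart α β) γ =
      (α.map (rows (0 : Fin 4) 1) ⊔ β.map (rows 1 2) ⊔ γ.map (rows 2 3)).comap (rows 0 3) := by
    have sq : ((productDiagram α β).map (Prod.map ![(0 : Fin 4), 1, 2] id)).comap
        (Prod.map ![(0 : Fin 4), 2, 3] id) = (productPart α β).map (rows 0 1) := by
      refine comap_map_square _ (inj _ (by decide)) (inj _ (by decide))
        (rows_injective (by decide)) (by rw [map_rows, map_rows]; rfl) ?_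
      rintro ⟨a, i⟩ ⟨b, j⟩ h
      fin_cases a <;> fin_cases b <;> simp at h <;> subst h
      · exact ⟨Sum.inl i, rfl, rfl⟩
      · exact ⟨Sum.inr i, rfl, rfl⟩
    rw [productPart, productDiagram, ← sq, ← comap_sup_map, ← Setoid.comap_comp, map_rows,
      productDiagram, map_sup, map_map, map_map, map_map, map_rows, map_rows, map_rows]
    rfl
  have hr : productPart α (productPart β γ) =
      (α.map (rows (0 : Fin 4) 1) ⊔ β.map (rows 1 2) ⊔ γ.map (rows 2 3)).comap (rows 0 3) := by
    have sq : ((productDiagram β γ).map (Prod.map ![(1 : Fin 4), 2, 3] id)).comap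
        (Prod.map ![(0 : Fin 4), 1, 3] id) = (productPart β γ).map (rows 1 2) := by
      refine comap_map_square _ (inj _ (by decide)) (inj _ (by decide))
        (rows_injective (by decide)) (by rw [map_rows, map_rows]; rfl) ?_
      rintro ⟨a, i⟩ ⟨b, j⟩ h
      fin_cases a <;> fin_cases b <;> simp at h <;> subst h
      · exact ⟨Sum.inl i, rfl, rfl⟩
      · exact ⟨Sum.inr i, rfl, rfl⟩
    rw [productPart, productDiagram, ← sq, sup_comm, ← comap_sup_map, ← Setoid.comap_comp,
      map_rows, productDiagram, map_sup, map_map, map_map, map_map, map_rows, map_rows, map_rows,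
      sup_comm, ← sup_assoc]
    rfl
  rw [hl, hr]

/-- The product of partial Brauer partitions. -/
instance PB.semigroup (n : ℕ) : Semigroup (PB n) where
  mul α β := ⟨productPart α.part β.part, isOneTwo_productPart α.isOneTwo β.isOneTwo⟩
  mul_assoc α β γ := PB.ext (productPart_assoc α.part β.part γ.part)

/-- The kernel of `α`. -/
def PB.ker {n : ℕ} (α : PB n) : Setoid (Fin n) := α.part.comap Sum.inl

/-- The cokernel of `α`. -/
def PB.coker {n : ℕ} (α : PB n) : Setoid (Fin n) := α.part.comap Sum.inr

/-- The rank of `α`: the number of blocks that meet both `[n]` and `[n]'`. -/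
noncomputable def PB.rank {n : ℕ} (α : PB n) : ℕ :=
  {C ∈ α.part.classes | (∃ i, Sum.inl i ∈ C) ∧ ∃ j, Sum.inr j ∈ C}.ncard

/-- The number of singleton classes of an equivalence. -/
noncomputable def numSingletons {T : Type*} (ε : Setoid T) : ℕ :=
  {C ∈ ε.classes | ∃ x, C = {x}}.ncard

/-- `D_q^α = {ξ ∈ P^α : rank ξ = q}`. -/
def regD {n : ℕ} (α : PB n) (q : ℕ) : Set (PB n) := {ξ | ξ ∈ pSet α ∧ ξ.rank = q}

/-! ### PB-pairs and the numbers `μ` -/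

/-- `(ε, X)` is a PB-pair: `ε` is a 1-2-equivalence and each element of `X` forms a singleton
class. -/
def IsPBPair {T : Type*} (ε : Setoid T) (X : Set T) : Prop :=
  IsOneTwo ε ∧ ∀ x ∈ X, {x} ∈ ε.classes

/-- The rank of the join `(ε₁, X₁) ∨ (ε₂, X₂)`. -/
noncomputable def joinRank {T : Type*} (ε₁ : Setoid T) (X₁ : Set T) (ε₂ : Setoid T)
    (X₂ : Set T) : ℕ :=
  {p : T × T | p.1 ∈ X₁ ∧ p.2 ∈ X₂ ∧ (ε₁ ⊔ ε₂) p.1 p.2}.ncard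

/-- The equivalence `ε_{m,k}` (for `k ≤ m` and `k ≡ m` mod 2) whose classes are, in the 0-based
numbering, `{0}, …, {k-1}, {k, k+1}, …, {m-2, m-1}`. -/
def stdEquiv (m k : ℕ) : Setoid (Fin m) :=
  Setoid.ker fun i : Fin m => if (i : ℕ) < k then (i : ℕ) else k + ((i : ℕ) - k) / 2

/-- The subset `[t]` of `[m]`, for `t ≤ m`, in the 0-based numbering. -/
def initialSeg (m t : ℕ) : Set (Fin m) := {i | (i : ℕ) < t}

open Classical in
/-- `μ(m, k, t, q)` is the number of PB-pairs `(η, X)` on `[m]` with `|X| = q` whose join with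
`(ε_{m,k}, [t])` has rank `q`; it is `0` if `ε_{m,k}` is undefined or `(ε_{m,k}, [t])` is not a
PB-pair on `[m]`. -/
noncomputable def mu (m k t q : ℕ) : ℕ :=
  if k ≤ m ∧ k ≡ m [MOD 2] ∧ t ≤ m ∧ IsPBPair (stdEquiv m k) (initialSeg m t) then
    {p : Setoid (Fin m) × Set (Fin m) | IsPBPair p.1 p.2 ∧ p.2.ncard = q ∧
      joinRank (stdEquiv m k) (initialSeg m t) p.1 p.2 = q}.ncard
  else 0

end PartialBrauer

namespace PartialBrauer

/-! ### Green's relations in a semigroup and in its variants -/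

section Green

variable {S : Type*} [Semigroup S]

/-! Each partition is encoded by two PB-pairs of equal size, (ker, dom) above and (coker, codom)
below, together with a bijection from dom to codom. In the monoid, R-classes correspond to upper
pairs and L-classes to lower pairs (`greenR_PB_iff`, `greenL_PB_iff`), because σσ*ξ = ξ whenever σ
and ξ share the upper pair.

Reading off the blocks of ξα shows that ξα R ξ holds exactly when every point of codom ξ is joined,
in ker α ∨ coker ξ, to a point of dom α (`greenR_mul_PB_iff`). This concerns only the lower pair of
ξ; dually, αξ L ξ concerns only its upper pair. The two pairs of an element of `regD α q` can
therefore be chosen independently, subject to having size q, and `exists_PB` realises every choice.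
Since the relations R and L of the variant agree on the P-set with those of the monoid, this gives a
single D-class. Its elements are regular because x = xas = tax and x = xx*x yield x = xa(sx*t)ax.

Counting L-classes now means counting PB-pairs of size q linked to (ker α, dom α). For a pair (η,
X), being linked is the same as the join having rank |X| (`joinRank_eq_iff`). Finally, up to
relabelling a PB-pair depends only on the number of vertices, of singleton classes and of
distinguished points (`IsPBPair.exists_equiv`), so (ker α, dom α) may be replaced by the standard
pair in the definition of `mu`. R-classes are treated dually with (coker α, codom α). -/

theorem leftIdeal_subset_iff {x y : S} :
    leftIdeal x ⊆ leftIdeal y ↔ x = y ∨ ∃ s, x = s * y := by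
  constructor
  · exact fun h => h (Set.mem_insert x _)
  · rintro (rfl | ⟨s, rfl⟩)
    · exact subset_rfl
    · rintro z (rfl | ⟨t, rfl⟩)
      · exact Or.inr ⟨s, rfl⟩
      · exact Or.inr ⟨t * s, (mul_assoc _ _ _).symm⟩

theorem rightIdeal_subset_iff {x y : S} :
    rightIdeal x ⊆ rightIdeal y ↔ x = y ∨ ∃ s, x = y * s := by
  constructor
  · exact fun h => h (Set.mem_insert x _)
  · rintro (rfl | ⟨s, rfl⟩)
    · exact subset_rfl
    · rintro z (rfl | ⟨t, rfl⟩)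
      · exact Or.inr ⟨s, rfl⟩
      · exact Or.inr ⟨s * t, mul_assoc _ _ _⟩

theorem greenL_iff {x y : S} :
    greenL S x y ↔ (x = y ∨ ∃ s, x = s * y) ∧ (y = x ∨ ∃ s, y = s * x) := by
  rw [← leftIdeal_subset_iff, ← leftIdeal_subset_iff]
  exact subset_antisymm_iff

theorem greenR_iff {x y : S} :
    greenR S x y ↔ (x = y ∨ ∃ s, x = y * s) ∧ (y = x ∨ ∃ s, y = x * s) := by
  rw [← rightIdeal_subset_iff, ← rightIdeal_subset_iff]
  exact subset_antisymm_iff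

theorem greenL_variant_def {a x y : S} : greenL (Variant a) x y ↔
    (x = y ∨ ∃ s : S, x = s * a * y) ∧ (y = x ∨ ∃ s : S, y = s * a * x) :=
  greenL_iff (S := Variant a)

theorem greenR_variant_def {a x y : S} : greenR (Variant a) x y ↔
    (x = y ∨ ∃ s : S, x = y * a * s) ∧ (y = x ∨ ∃ s : S, y = x * a * s) :=
  greenR_iff (S := Variant a)

theorem greenL_of_variant {a x y : S} (h : greenL (Variant a) x y) : greenL S x y := by
  obtain ⟨h1, h2⟩ := greenL_variant_def.1 h
  exact greenL_iff.2 ⟨h1.imp id fun ⟨s, hs⟩ => ⟨_, hs⟩, h2.imp id fun ⟨s, hs⟩ => ⟨_, hs⟩⟩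

theorem greenR_of_variant {a x y : S} (h : greenR (Variant a) x y) : greenR S x y := by
  obtain ⟨h1, h2⟩ := greenR_variant_def.1 h
  exact greenR_iff.2 ⟨h1.imp id fun ⟨s, hs⟩ => ⟨a * s, hs.trans (mul_assoc _ _ _)⟩,
    h2.imp id fun ⟨s, hs⟩ => ⟨a * s, hs.trans (mul_assoc _ _ _)⟩⟩

end Green

/-- In a semigroup where `x ∈ xS` for all `x`, the condition `xa R x` says that `x ∈ xaS`. -/
theorem greenR_mul_iff {S : Type*} [Semigroup S] (hS : ∀ x : S, ∃ e, x = x * e) {x a : S} :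
    greenR S (x * a) x ↔ ∃ s, x = x * a * s := by
  rw [greenR_iff]
  constructor
  · rintro ⟨-, h | h⟩
    · obtain ⟨e, he⟩ := hS x
      exact ⟨e, by rw [← h]; exact he⟩
    · exact h
  · exact fun h => ⟨Or.inr ⟨a, rfl⟩, Or.inr h⟩

theorem greenL_mul_iff {S : Type*} [Semigroup S] (hS : ∀ x : S, ∃ e, x = e * x) {x a : S} :
    greenL S (a * x) x ↔ ∃ s, x = s * a * x := by
  rw [greenL_iff]
  constructor
  · rintro ⟨-, h | ⟨s, h⟩⟩
    · obtain ⟨e, he⟩ := hS x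
      refine ⟨e, ?_⟩
      rw [mul_assoc, ← h]
      exact he
    · exact ⟨s, by rw [mul_assoc]; exact h⟩
  · rintro ⟨s, h⟩
    exact ⟨Or.inr ⟨a, rfl⟩, Or.inr ⟨s, by rw [← mul_assoc]; exact h⟩⟩

/-! ### The blocks of a product -/

variable {n : ℕ}

theorem PB.eq_or_eq (α : PB n) {x y z : Fin n ⊕ Fin n} (h : α.part x y) (h' : α.part x z) :
    x = y ∨ x = z ∨ y = z :=
  isOneTwo_iff.1 α.isOneTwo x y z h h'

theorem PB.inr_unique (α : PB n) {i j k : Fin n} (h : α.part (.inl i) (.inr j))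
    (h' : α.part (.inl i) (.inr k)) : j = k := by
  simpa using α.eq_or_eq h h'

theorem PB.inl_unique (α : PB n) {i j k : Fin n} (h : α.part (.inl i) (.inr k))
    (h' : α.part (.inl j) (.inr k)) : i = j := by
  simpa using α.eq_or_eq (α.part.symm h) (α.part.symm h')

theorem PB.inl_eq (α : PB n) {i j k : Fin n} (h : α.part (.inl i) (.inr k))
    (h' : α.part (.inl i) (.inl j)) : i = j := by
  simpa using α.eq_or_eq h h'

theorem PB.inr_eq (α : PB n) {i j k : Fin n} (h : α.part (.inl i) (.inr k))
    (h' : α.part (.inr k) (.inr j)) : k = j := by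
  simpa using α.eq_or_eq (α.part.symm h) h'

/-- The equivalence induced on the middle row of the product diagram. -/
def middle (α β : PB n) : Setoid (Fin n) := α.coker ⊔ β.ker

open Classical in
/-- A label of the connected components of the product diagram. -/
noncomputable def componentLabel (α β : PB n) (v : Fin 3 × Fin n) :
    Quotient (middle α β) ⊕ (Quotient α.ker ⊕ Quotient β.coker) :=
  if v.1 = 0 then
    if h : ∃ x, α.part (.inl v.2) (.inr x) then .inl (Quotient.mk _ h.choose)
    else .inr (.inl (Quotient.mk _ v.2))
  else if v.1 = 1 then .inl (Quotient.mk _ v.2)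
  else
    if h : ∃ x, β.part (.inl x) (.inr v.2) then .inl (Quotient.mk _ h.choose)
    else .inr (.inr (Quotient.mk _ v.2))

theorem componentLabel_one (α β : PB n) (x : Fin n) :
    componentLabel α β (1, x) = .inl (Quotient.mk _ x) := by
  simp [componentLabel]

theorem componentLabel_zero {α : PB n} (β : PB n) {i x : Fin n} (h : α.part (.inl i) (.inr x)) :
    componentLabel α β (0, i) = .inl (Quotient.mk _ x) := by
  have h' : ∃ x, α.part (.inl i) (.inr x) := ⟨x, h⟩
  simp only [componentLabel, if_true, dif_pos h', α.inr_unique h'.choose_spec h]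

theorem componentLabel_zero' {α : PB n} (β : PB n) {i : Fin n}
    (h : ¬ ∃ x, α.part (.inl i) (.inr x)) :
    componentLabel α β (0, i) = .inr (.inl (Quotient.mk _ i)) := by
  simp only [componentLabel, if_true, dif_neg h]

theorem componentLabel_two (α : PB n) {β : PB n} {x k : Fin n} (h : β.part (.inl x) (.inr k)) :
    componentLabel α β (2, k) = .inl (Quotient.mk _ x) := by
  have h' : ∃ x, β.part (.inl x) (.inr k) := ⟨x, h⟩
  have h1 : componentLabel α β (2, k) = .inl (Quotient.mk _ h'.choose) := by
    simp [componentLabel, dif_pos h']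
  rw [h1, β.inl_unique h'.choose_spec h]

theorem componentLabel_two' (α : PB n) {β : PB n} {k : Fin n}
    (h : ¬ ∃ x, β.part (.inl x) (.inr k)) :
    componentLabel α β (2, k) = .inr (.inr (Quotient.mk _ k)) := by
  simp [componentLabel, dif_neg h]

/-- The label is constant along every edge of either diagram, hence on connected components. This
replaces induction on paths: vertices with different labels cannot be connected. -/
theorem productDiagram_le_ker (α β : PB n) :
    productDiagram α.part β.part ≤ Setoid.ker (componentLabel α β) := by
  have hα : α.coker ≤ middle α β := le_sup_left
  have hβ : β.ker ≤ middle α β := le_sup_right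
  have cross : ∀ i x, α.part (.inl i) (.inr x) →
      componentLabel α β (0, i) = componentLabel α β (1, x) := fun i x h => by
    rw [componentLabel_zero β h, componentLabel_one]
  have cross' : ∀ x k, β.part (.inl x) (.inr k) →
      componentLabel α β (1, x) = componentLabel α β (2, k) := fun x k h => by
    rw [componentLabel_two α h, componentLabel_one]
  refine sup_le (map_le_iff.2 ?_) (map_le_iff.2 ?_)
  · rintro (i | i) (j | j) h
    · change componentLabel α β (0, i) = componentLabel α β (0, j)
      by_cases hi : ∃ x, α.part (.inl i) (.inr x)
      · obtain ⟨x, hx⟩ := hi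
        rw [α.inl_eq hx h]
      · have hj : ¬ ∃ x, α.part (.inl j) (.inr x) :=
          fun ⟨x, hx⟩ => hi ⟨x, α.part.trans h hx⟩
        rw [componentLabel_zero' β hi, componentLabel_zero' β hj]
        exact congrArg _ (congrArg _ (Quotient.sound h))
    · exact cross i j h
    · exact (cross j i (α.part.symm h)).symm
    · change componentLabel α β (1, i) = componentLabel α β (1, j)
      rw [componentLabel_one, componentLabel_one]
      exact congrArg _ (Quotient.sound (hα h))
  · rintro (i | i) (j | j) h
    · change componentLabel α β (1, i) = componentLabel α β (1, j)
      rw [componentLabel_one, componentLabel_one]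
      exact congrArg _ (Quotient.sound (hβ h))
    · exact cross' i j h
    · exact (cross' j i (β.part.symm h)).symm
    · change componentLabel α β (2, i) = componentLabel α β (2, j)
      by_cases hi : ∃ x, β.part (.inl x) (.inr i)
      · obtain ⟨x, hx⟩ := hi
        rw [β.inr_eq hx h]
      · have hj : ¬ ∃ x, β.part (.inl x) (.inr j) :=
          fun ⟨x, hx⟩ => hi ⟨x, β.part.trans hx (β.part.symm h)⟩
        rw [componentLabel_two' α hi, componentLabel_two' α hj]
        exact congrArg _ (congrArg _ (Quotient.sound h))

theorem productDiagram_left (α β : PB n) {x y : Fin n ⊕ Fin n} (h : α.part x y) :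
    productDiagram α.part β.part (rows 0 1 x) (rows 0 1 y) :=
  (le_sup_left : _ ≤ productDiagram α.part β.part) (Setoid.le_comap_map h)

theorem productDiagram_right (α β : PB n) {x y : Fin n ⊕ Fin n} (h : β.part x y) :
    productDiagram α.part β.part (rows 1 2 x) (rows 1 2 y) :=
  (le_sup_right : _ ≤ productDiagram α.part β.part) (Setoid.le_comap_map h)

theorem productDiagram_middle (α β : PB n) {x y : Fin n} (h : middle α β x y) :
    productDiagram α.part β.part (1, x) (1, y) := by
  have hle : middle α β ≤ (productDiagram α.part β.part).comap (fun x => ((1 : Fin 3), x)) :=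
    sup_le (fun x y h => productDiagram_left α β h) (fun x y h => productDiagram_right α β h)
  exact hle h

/-- Labels distinguish components meeting the middle row from those confined to one outer row. Equal
labels thus mean either a common upper block of `α`, or two descents to the middle row at points
related there. -/
theorem mul_inl_inl {α β : PB n} {i j : Fin n} :
    (α * β).part (.inl i) (.inl j) ↔ α.part (.inl i) (.inl j) ∨
      ∃ x y, α.part (.inl i) (.inr x) ∧ α.part (.inl j) (.inr y) ∧ middle α β x y := by
  constructor
  · intro h
    have h' : componentLabel α β (0, i) = componentLabel α β (0, j) := productDiagram_le_ker α β h
    by_cases hi : ∃ x, α.part (.inl i) (.inr x) <;> by_cases hj : ∃ x, α.part (.inl j) (.inr x)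
    · obtain ⟨x, hx⟩ := hi
      obtain ⟨y, hy⟩ := hj
      rw [componentLabel_zero β hx, componentLabel_zero β hy] at h'
      exact Or.inr ⟨x, y, hx, hy, Quotient.exact (Sum.inl.inj h')⟩
    · obtain ⟨x, hx⟩ := hi
      rw [componentLabel_zero β hx, componentLabel_zero' β hj] at h'
      cases h'
    · obtain ⟨x, hx⟩ := hj
      rw [componentLabel_zero β hx, componentLabel_zero' β hi] at h'
      cases h'
    · rw [componentLabel_zero' β hi, componentLabel_zero' β hj] at h'
      have h'' : α.ker i j := Quotient.exact (Sum.inl.inj (Sum.inr.inj h'))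
      exact Or.inl h''
  · rintro (h | ⟨x, y, hx, hy, h⟩)
    · exact productDiagram_left α β h
    · exact Setoid.trans' (productDiagram α.part β.part) (productDiagram_left α β hx) (Setoid.trans' _
        (productDiagram_middle α β h) (productDiagram_left α β (α.part.symm hy)))

theorem mul_inl_inr {α β : PB n} {i k : Fin n} :
    (α * β).part (.inl i) (.inr k) ↔
      ∃ x y, α.part (.inl i) (.inr x) ∧ β.part (.inl y) (.inr k) ∧ middle α β x y := by
  constructor
  · intro h
    have h' : componentLabel α β (0, i) = componentLabel α β (2, k) := productDiagram_le_ker α β h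
    by_cases hi : ∃ x, α.part (.inl i) (.inr x) <;> by_cases hk : ∃ x, β.part (.inl x) (.inr k)
    · obtain ⟨x, hx⟩ := hi
      obtain ⟨y, hy⟩ := hk
      rw [componentLabel_zero β hx, componentLabel_two α hy] at h'
      exact ⟨x, y, hx, hy, Quotient.exact (Sum.inl.inj h')⟩
    · obtain ⟨x, hx⟩ := hi
      rw [componentLabel_zero β hx, componentLabel_two' α hk] at h'
      cases h'
    · obtain ⟨x, hx⟩ := hk
      rw [componentLabel_two α hx, componentLabel_zero' β hi] at h'
      cases h'
    · rw [componentLabel_zero' β hi, componentLabel_two' α hk] at h'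
      cases h'
  · rintro ⟨x, y, hx, hy, h⟩
    exact Setoid.trans' (productDiagram α.part β.part) (productDiagram_left α β hx) (Setoid.trans' _
        (productDiagram_middle α β h) (productDiagram_right α β hy))

theorem mul_inr_inr {α β : PB n} {k l : Fin n} :
    (α * β).part (.inr k) (.inr l) ↔ β.part (.inr k) (.inr l) ∨
      ∃ x y, β.part (.inl x) (.inr k) ∧ β.part (.inl y) (.inr l) ∧ middle α β x y := by
  constructor
  · intro h
    have h' : componentLabel α β (2, k) = componentLabel α β (2, l) := productDiagram_le_ker α β h
    by_cases hk : ∃ x, β.part (.inl x) (.inr k) <;> by_cases hl : ∃ x, β.part (.inl x) (.inr l)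
    · obtain ⟨x, hx⟩ := hk
      obtain ⟨y, hy⟩ := hl
      rw [componentLabel_two α hx, componentLabel_two α hy] at h'
      exact Or.inr ⟨x, y, hx, hy, Quotient.exact (Sum.inl.inj h')⟩
    · obtain ⟨x, hx⟩ := hk
      rw [componentLabel_two α hx, componentLabel_two' α hl] at h'
      cases h'
    · obtain ⟨x, hx⟩ := hl
      rw [componentLabel_two α hx, componentLabel_two' α hk] at h'
      cases h'
    · rw [componentLabel_two' α hk, componentLabel_two' α hl] at h'
      have h'' : β.coker k l := Quotient.exact (Sum.inr.inj (Sum.inr.inj h'))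
      exact Or.inl h''
  · rintro (h | ⟨x, y, hx, hy, h⟩)
    · exact productDiagram_right α β h
    · exact Setoid.trans' (productDiagram α.part β.part) (productDiagram_right α β (β.part.symm hx)) (Setoid.trans' _
        (productDiagram_middle α β h) (productDiagram_right α β hy))

theorem PB.ext_blocks {α β : PB n}
    (h1 : ∀ i j, α.part (.inl i) (.inl j) ↔ β.part (.inl i) (.inl j))
    (h2 : ∀ i k, α.part (.inl i) (.inr k) ↔ β.part (.inl i) (.inr k))
    (h3 : ∀ k l, α.part (.inr k) (.inr l) ↔ β.part (.inr k) (.inr l)) : α = β := by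
  refine PB.ext (Setoid.ext ?_)
  rintro (i | i) (j | j)
  · exact h1 i j
  · exact h2 i j
  · exact ⟨fun h => β.part.symm ((h2 j i).1 (α.part.symm h)),
      fun h => α.part.symm ((h2 j i).2 (β.part.symm h))⟩
  · exact h3 i j

/-! ### The involution -/

/-- The partition obtained by exchanging the two rows. -/
def PB.star (α : PB n) : PB n where
  part := α.part.comap Sum.swap
  isOneTwo := by
    have h := isOneTwo_iff.1 α.isOneTwo
    refine isOneTwo_iff.2 fun x y z hxy hxz => ?_
    have := h _ _ _ hxy hxz
    simpa only [(Sum.swap_leftInverse).injective.eq_iff] using this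

@[simp]
theorem PB.star_star (α : PB n) : α.star.star = α :=
  PB.ext (Setoid.ext fun x y => by
    change α.part x.swap.swap y.swap.swap ↔ _
    rw [Sum.swap_swap, Sum.swap_swap])

theorem PB.star_inl_inr {α : PB n} {i k : Fin n} :
    α.star.part (.inl i) (.inr k) ↔ α.part (.inl k) (.inr i) :=
  ⟨α.part.symm, α.part.symm⟩

theorem PB.ker_star (α : PB n) : α.star.ker = α.coker := rfl

theorem PB.coker_star (α : PB n) : α.star.coker = α.ker := rfl

theorem middle_star (α β : PB n) : middle β.star α.star = middle α β := sup_comm _ _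

theorem star_mul (α β : PB n) : (α * β).star = β.star * α.star := by
  refine PB.ext_blocks (fun i j => ?_) (fun i j => ?_) (fun i j => ?_)
  · rw [mul_inl_inl, middle_star]
    simp only [PB.star_inl_inr]
    exact mul_inr_inr
  · rw [mul_inl_inr, middle_star, PB.star_inl_inr, mul_inl_inr]
    simp only [PB.star_inl_inr]
    constructor
    · rintro ⟨x, y, h1, h2, h3⟩
      exact ⟨y, x, h2, h1, Setoid.symm' _ h3⟩
    · rintro ⟨x, y, h1, h2, h3⟩
      exact ⟨y, x, h2, h1, Setoid.symm' _ h3⟩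
  · rw [mul_inr_inr, middle_star]
    simp only [PB.star_inl_inr]
    exact mul_inl_inl

/-! ### Domain, codomain and rank -/

/-- The elements of the upper row that lie in blocks meeting the lower row. -/
def PB.dom (α : PB n) : Set (Fin n) := {i | ∃ k, α.part (.inl i) (.inr k)}

/-- The elements of the lower row that lie in blocks meeting the upper row. -/
def PB.codom (α : PB n) : Set (Fin n) := {k | ∃ i, α.part (.inl i) (.inr k)}

theorem PB.dom_star (α : PB n) : α.star.dom = α.codom := by
  simp only [PB.dom, PB.codom, PB.star_inl_inr]

theorem PB.codom_star (α : PB n) : α.star.codom = α.dom := by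
  simp only [PB.dom, PB.codom, PB.star_inl_inr]

/-- A block meeting both rows has exactly one point in each, so such blocks correspond to their
upper endpoints. -/
theorem PB.rank_eq_ncard_dom (α : PB n) : α.rank = α.dom.ncard := by
  have h : {C ∈ α.part.classes | (∃ i, Sum.inl i ∈ C) ∧ ∃ j, Sum.inr j ∈ C} =
      (fun i => {w | α.part w (.inl i)}) '' α.dom := by
    ext C
    constructor
    · rintro ⟨⟨x, rfl⟩, ⟨i, hi⟩, k, hk⟩
      refine ⟨i, ⟨k, α.part.trans hi (α.part.symm hk)⟩, ?_⟩
      ext w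
      exact ⟨fun hw => α.part.trans hw hi, fun hw => α.part.trans hw (α.part.symm hi)⟩
    · rintro ⟨i, ⟨k, hk⟩, rfl⟩
      exact ⟨α.part.mem_classes _, ⟨i, α.part.refl _⟩, k, α.part.symm hk⟩
  rw [PB.rank, h]
  refine Set.InjOn.ncard_image ?_
  rintro i ⟨k, hk⟩ j - hij
  have : (Sum.inl i : Fin n ⊕ Fin n) ∈ {w | α.part w (.inl j)} := by
    rw [← show {w | α.part w (.inl i)} = {w | α.part w (.inl j)} from hij]
    exact α.part.refl _
  exact α.inl_eq hk this

theorem PB.rank_eq_ncard_codom (α : PB n) : α.rank = α.codom.ncard := by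
  have h : {C ∈ α.part.classes | (∃ i, Sum.inl i ∈ C) ∧ ∃ j, Sum.inr j ∈ C} =
      (fun k => {w | α.part w (.inr k)}) '' α.codom := by
    ext C
    constructor
    · rintro ⟨⟨x, rfl⟩, ⟨i, hi⟩, k, hk⟩
      refine ⟨k, ⟨i, α.part.trans hi (α.part.symm hk)⟩, ?_⟩
      ext w
      exact ⟨fun hw => α.part.trans hw hk, fun hw => α.part.trans hw (α.part.symm hk)⟩
    · rintro ⟨k, ⟨i, hi⟩, rfl⟩
      exact ⟨α.part.mem_classes _, ⟨i, hi⟩, k, α.part.refl _⟩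
  rw [PB.rank, h]
  refine Set.InjOn.ncard_image ?_
  rintro k ⟨i, hi⟩ l - hkl
  have : (Sum.inr k : Fin n ⊕ Fin n) ∈ {w | α.part w (.inr l)} := by
    rw [← show {w | α.part w (.inr k)} = {w | α.part w (.inr l)} from hkl]
    exact α.part.refl _
  exact α.inr_eq hi this

theorem singleton_mem_classes {T : Type*} {ε : Setoid T} {x : T} :
    {x} ∈ ε.classes ↔ ∀ y, ε x y → y = x := by
  constructor
  · rintro ⟨z, hz⟩ y hxy
    have hx : x ∈ {w | ε w z} := hz ▸ Set.mem_singleton x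
    have : y ∈ ({x} : Set T) := hz ▸ (ε.trans (ε.symm hxy) hx : ε y z)
    exact this
  · intro h
    refine ⟨x, Set.ext fun y => ⟨?_, fun hy => h y (ε.symm hy)⟩⟩
    rintro rfl
    exact ε.refl _

theorem isPBPair_iff {T : Type*} {ε : Setoid T} {X : Set T} :
    IsPBPair ε X ↔ IsOneTwo ε ∧ ∀ x ∈ X, ∀ y, ε x y → y = x := by
  simp only [IsPBPair, singleton_mem_classes]

theorem PB.isPBPair_ker (α : PB n) : IsPBPair α.ker α.dom := by
  refine isPBPair_iff.2 ⟨isOneTwo_iff.2 fun x y z h h' => ?_, ?_⟩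
  · simpa using α.eq_or_eq h h'
  · rintro x ⟨k, hk⟩ y hy
    exact (α.inl_eq hk hy).symm

theorem PB.isPBPair_coker (α : PB n) : IsPBPair α.coker α.codom := by
  rw [← PB.ker_star, ← PB.dom_star]
  exact α.star.isPBPair_ker

/-- Any two PB-pairs of the same size are the kernel-domain and the cokernel-codomain pairs of a
partition. -/
theorem exists_PB {η η' : Setoid (Fin n)} {X X' : Set (Fin n)} (h : IsPBPair η X)
    (h' : IsPBPair η' X') (hX : X.ncard = X'.ncard) :
    ∃ ξ : PB n, ξ.ker = η ∧ ξ.dom = X ∧ ξ.coker = η' ∧ ξ.codom = X' := by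
  classical
  rw [isPBPair_iff, isOneTwo_iff] at h h'
  obtain ⟨e⟩ : Nonempty (X ≃ X') := Finite.card_eq.1 hX
  -- The partition is the kernel of a labelling: a point of `X` takes the label of its partner under
  -- `e`, any other upper point keeps its own class in a separate summand.
  let f : Fin n ⊕ Fin n → Quotient η ⊕ Quotient η' :=
    Sum.elim (fun i => if hi : i ∈ X then .inr (Quotient.mk _ (e ⟨i, hi⟩ : Fin n))
      else .inl (Quotient.mk _ i)) (fun k => .inr (Quotient.mk _ k))
  have hll : ∀ i j, f (.inl i) = f (.inl j) ↔ η i j := by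
    intro i j
    by_cases hi : i ∈ X <;> by_cases hj : j ∈ X
    · simp only [f, Sum.elim_inl, dif_pos hi, dif_pos hj, Sum.inr.injEq]
      constructor
      · intro hij
        have := h'.2 _ (e ⟨i, hi⟩).2 _ (Quotient.exact hij)
        have := congrArg Subtype.val (e.injective (Subtype.ext this))
        rw [show j = i from this]
      · intro hij
        have := h.2 i hi j hij
        subst this
        rfl
    · simp only [f, Sum.elim_inl, dif_pos hi, dif_neg hj, reduceCtorEq, false_iff]
      exact fun hij => hj (h.2 i hi j hij ▸ hi)
    · simp only [f, Sum.elim_inl, dif_neg hi, dif_pos hj, reduceCtorEq, false_iff]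
      exact fun hij => hi (h.2 j hj i (η.symm hij) ▸ hj)
    · simp only [f, Sum.elim_inl, dif_neg hi, dif_neg hj, Sum.inl.injEq]
      exact Quotient.eq
  have hrr : ∀ k l, f (.inr k) = f (.inr l) ↔ η' k l := by
    intro k l
    simp only [f, Sum.elim_inr, Sum.inr.injEq]
    exact Quotient.eq
  have hlr : ∀ i k, f (.inl i) = f (.inr k) ↔ ∃ hi : i ∈ X, (e ⟨i, hi⟩ : Fin n) = k := by
    intro i k
    by_cases hi : i ∈ X
    · rw [exists_prop_of_true hi]
      simp only [f, Sum.elim_inl, Sum.elim_inr, dif_pos hi, Sum.inr.injEq]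
      constructor
      · exact fun hik => (h'.2 _ (e ⟨i, hi⟩).2 _ (Quotient.exact hik)).symm
      · rintro rfl
        rfl
    · simp [f, hi]
  refine ⟨⟨Setoid.ker f, isOneTwo_iff.2 ?_⟩, Setoid.ext fun i j => hll i j, ?_,
    Setoid.ext fun k l => hrr k l, ?_⟩
  · have hl : ∀ i j k, f (.inl i) = f (.inl j) → f (.inl i) = f (.inr k) → i = j := by
      intro i j k hij hik
      obtain ⟨hi, -⟩ := (hlr i k).1 hik
      exact (h.2 i hi j ((hll i j).1 hij)).symm
    have hr : ∀ i k l, f (.inl i) = f (.inr k) → f (.inr k) = f (.inr l) → k = l := by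
      intro i k l hik hkl
      obtain ⟨hi, rfl⟩ := (hlr i k).1 hik
      exact (h'.2 _ (e ⟨i, hi⟩).2 l ((hrr _ l).1 hkl)).symm
    rintro (x | x) (y | y) (z | z) hxy hxz <;> simp only [Setoid.ker_def] at hxy hxz
    · simpa using h.1 x y z ((hll x y).1 hxy) ((hll x z).1 hxz)
    · exact Or.inl (congrArg _ (hl x y z hxy hxz))
    · exact Or.inr (Or.inl (congrArg _ (hl x z y hxz hxy)))
    · exact Or.inr (Or.inr (congrArg _ (hr x y z hxy (hxy.symm.trans hxz))))
    · exact Or.inr (Or.inr (congrArg _ (hl y z x (hxy.symm.trans hxz) hxy.symm)))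
    · exact Or.inr (Or.inl (congrArg _ (hr y x z hxy.symm hxz)))
    · exact Or.inl (congrArg _ (hr z x y hxz.symm hxy))
    · simpa using h'.1 x y z ((hrr x y).1 hxy) ((hrr x z).1 hxz)
  · ext i
    constructor
    · rintro ⟨k, hk⟩
      exact ((hlr i k).1 hk).1
    · exact fun hi => ⟨_, (hlr i _).2 ⟨hi, rfl⟩⟩
  · ext k
    constructor
    · rintro ⟨i, hi⟩
      obtain ⟨hi, rfl⟩ := (hlr i k).1 hi
      exact (e _).2
    · intro hk
      exact ⟨_, (hlr _ k).2 ⟨(e.symm ⟨k, hk⟩).2, by simp⟩⟩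

/-! ### Green's relations of the partial Brauer monoid -/

theorem ker_le_ker_mul (α β : PB n) : α.ker ≤ (α * β).ker :=
  fun _ _ h => mul_inl_inl.2 (Or.inl h)

theorem dom_mul_subset (α β : PB n) : (α * β).dom ⊆ α.dom := by
  rintro i ⟨k, hk⟩
  obtain ⟨x, -, hx, -⟩ := mul_inl_inr.1 hk
  exact ⟨x, hx⟩

/-- The product of two partitions that fit together. -/
theorem mul_blocks_of_match {α β : PB n} (h : α.coker = β.ker) :
    (∀ i j, (α * β).part (.inl i) (.inl j) ↔ α.part (.inl i) (.inl j)) ∧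
    (∀ i k, (α * β).part (.inl i) (.inr k) ↔
      ∃ x, α.part (.inl i) (.inr x) ∧ β.part (.inl x) (.inr k)) ∧
    (∀ k l, (α * β).part (.inr k) (.inr l) ↔ β.part (.inr k) (.inr l)) := by
  -- Both factors induce the same equivalence on the middle row, so their join adds no connections.
  have hα : middle α β = α.coker := by rw [middle, ← h, sup_idem]
  have hβ : middle α β = β.ker := by rw [middle, h, sup_idem]
  refine ⟨fun i j => ?_, fun i k => ?_, fun k l => ?_⟩
  · rw [mul_inl_inl, or_iff_left_of_imp]
    rintro ⟨x, y, hx, hy, hxy⟩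
    rw [hα] at hxy
    exact α.part.trans hx (α.part.trans hxy (α.part.symm hy))
  · rw [mul_inl_inr]
    constructor
    · rintro ⟨x, y, hx, hy, hxy⟩
      rw [hα] at hxy
      exact ⟨x, hx, by rwa [α.inr_eq hx hxy]⟩
    · rintro ⟨x, hx, hx'⟩
      exact ⟨x, x, hx, hx', Setoid.refl' _ _⟩
  · rw [mul_inr_inr, or_iff_left_of_imp]
    rintro ⟨x, y, hx, hy, hxy⟩
    rw [hβ] at hxy
    exact β.part.trans (β.part.symm hx) (β.part.trans hxy hy)

/-- σσ* acts as the identity on the common domain and reproduces the common kernel. This yields the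
multipliers for Green's relations, as well as regularity and one-sided local identities when σ = ξ.
-/
theorem mul_star_mul {σ ξ : PB n} (hk : σ.ker = ξ.ker) (hd : σ.dom = ξ.dom) :
    σ * (σ.star * ξ) = ξ := by
  obtain ⟨h1, h2, h3⟩ := mul_blocks_of_match (α := σ.star) (β := ξ) (by rw [PB.coker_star, hk])
  obtain ⟨h1', h2', h3'⟩ := mul_blocks_of_match (α := σ) (β := σ.star * ξ)
    (Setoid.ext fun i j => (h1 i j).symm)
  refine PB.ext_blocks (fun i j => ?_) (fun i k => ?_) (fun k l => ?_)
  · rw [h1']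
    exact Setoid.ext_iff.1 hk i j
  · rw [h2']
    constructor
    · rintro ⟨x, hx, hx'⟩
      obtain ⟨y, hy, hy'⟩ := (h2 x k).1 hx'
      rwa [σ.inl_unique hx (PB.star_inl_inr.1 hy)]
    · intro h
      have hi : i ∈ σ.dom := hd ▸ ⟨k, h⟩
      obtain ⟨x, hx⟩ := hi
      exact ⟨x, hx, (h2 x k).2 ⟨i, PB.star_inl_inr.2 hx, h⟩⟩
  · rw [h3', h3]

/-- Right multiplication can only enlarge the kernel and shrink the domain, so mutual divisibility
forces equality; `mul_star_mul` supplies the converse. -/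
theorem greenR_PB_iff {σ ξ : PB n} :
    greenR (PB n) σ ξ ↔ σ.ker = ξ.ker ∧ σ.dom = ξ.dom := by
  constructor
  · intro h
    have key : ∀ {σ ξ : PB n}, (σ = ξ ∨ ∃ s, σ = ξ * s) → ξ.ker ≤ σ.ker ∧ σ.dom ⊆ ξ.dom := by
      rintro σ ξ (rfl | ⟨s, rfl⟩)
      · exact ⟨le_rfl, subset_rfl⟩
      · exact ⟨ker_le_ker_mul ξ s, dom_mul_subset ξ s⟩
    obtain ⟨h1, h2⟩ := greenR_iff.1 h
    exact ⟨le_antisymm (key h2).1 (key h1).1, subset_antisymm (key h1).2 (key h2).2⟩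
  · rintro ⟨hk, hd⟩
    exact greenR_iff.2 ⟨Or.inr ⟨_, (mul_star_mul hk.symm hd.symm).symm⟩,
      Or.inr ⟨_, (mul_star_mul hk hd).symm⟩⟩

theorem greenR_star_iff {σ ξ : PB n} :
    greenR (PB n) σ.star ξ.star ↔ greenL (PB n) σ ξ := by
  have key : ∀ {σ ξ : PB n}, (σ.star = ξ.star ∨ ∃ s, σ.star = ξ.star * s) ↔
      (σ = ξ ∨ ∃ s, σ = s * ξ) := by
    intro σ ξ
    have hinj : Function.Injective (PB.star : PB n → PB n) :=
      Function.LeftInverse.injective PB.star_star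
    refine or_congr hinj.eq_iff ⟨?_, ?_⟩
    · rintro ⟨s, hs⟩
      exact ⟨s.star, hinj (by rw [star_mul, PB.star_star, hs])⟩
    · rintro ⟨s, rfl⟩
      exact ⟨s.star, star_mul _ _⟩
  rw [greenR_iff, greenL_iff, key, key]

theorem greenL_PB_iff {σ ξ : PB n} :
    greenL (PB n) σ ξ ↔ σ.coker = ξ.coker ∧ σ.codom = ξ.codom := by
  rw [← greenR_star_iff, greenR_PB_iff, PB.dom_star, PB.dom_star, PB.ker_star, PB.ker_star]

theorem PB.mul_star_mul_self (ξ : PB n) : ξ * (ξ.star * ξ) = ξ := mul_star_mul rfl rfl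

/-- Each element of `X₂` is joined to an element of `X₁` in `ε₁ ∨ ε₂`. -/
def Linked {T : Type*} (ε₁ : Setoid T) (X₁ : Set T) (ε₂ : Setoid T) (X₂ : Set T) : Prop :=
  ∀ y ∈ X₂, ∃ x ∈ X₁, (ε₁ ⊔ ε₂) x y

/-- Linkedness says that no point of dom ξ is lost in ξα. The kernels then agree automatically: a
new upper block of ξα would need an endpoint in dom ξ = dom(ξα), which already has a partner in the
lower row. -/
theorem greenR_mul_PB_iff {α ξ : PB n} :
    greenR (PB n) (ξ * α) ξ ↔ Linked α.ker α.dom ξ.coker ξ.codom := by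
  have hm : α.ker ⊔ ξ.coker = middle ξ α := sup_comm _ _
  rw [greenR_PB_iff, Linked, hm]
  constructor
  · rintro ⟨-, hd⟩ y ⟨i, hi⟩
    have hi' : i ∈ (ξ * α).dom := hd ▸ ⟨y, hi⟩
    obtain ⟨k, hk⟩ := hi'
    obtain ⟨x, z, hx, hz, hxz⟩ := mul_inl_inr.1 hk
    exact ⟨z, ⟨k, hz⟩, ξ.inr_unique hx hi ▸ Setoid.symm' _ hxz⟩
  · intro h
    have hd : ξ.dom ⊆ (ξ * α).dom := by
      rintro i ⟨y, hy⟩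
      obtain ⟨x, ⟨k, hk⟩, hxy⟩ := h y ⟨i, hy⟩
      exact ⟨k, mul_inl_inr.2 ⟨y, x, hy, hk, Setoid.symm' _ hxy⟩⟩
    refine ⟨le_antisymm (fun i j hij => ?_) (ker_le_ker_mul _ _),
      subset_antisymm (dom_mul_subset _ _) hd⟩
    rcases mul_inl_inl.1 hij with h' | ⟨x, y, hx, -, -⟩
    · exact h'
    · obtain ⟨k, hk⟩ := hd ⟨x, hx⟩
      rw [(ξ * α).inl_eq hk hij]

theorem greenL_mul_PB_iff {α ξ : PB n} :
    greenL (PB n) (α * ξ) ξ ↔ Linked α.coker α.codom ξ.ker ξ.dom := by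
  rw [← greenR_star_iff, star_mul, greenR_mul_PB_iff, PB.ker_star, PB.dom_star, PB.coker_star,
    PB.codom_star]

end PartialBrauer
namespace PartialBrauer

/-! ### Regular elements and `D`-classes of a variant -/

section PSet

variable {S : Type*} [Semigroup S] {a x y : S}

theorem exists_mul_of_greenR (hS : ∀ x : S, ∃ e, x = x * e) (h : greenR S x y) :
    ∃ s, x = y * s := by
  rcases (greenR_iff.1 h).1 with rfl | h
  · exact hS x
  · exact h

theorem exists_mul_of_greenL (hS : ∀ x : S, ∃ e, x = e * x) (h : greenL S x y) :
    ∃ s, x = s * y := by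
  rcases (greenL_iff.1 h).1 with rfl | h
  · exact hS x
  · exact h

/-- From y = yat and x = ys one gets x = ya(ts): the P-set condition inserts the sandwich element
into any multiplier. -/
theorem greenR_variant_iff (hS : ∀ x : S, ∃ e, x = x * e) (hx : greenR S (x * a) x)
    (hy : greenR S (y * a) y) : greenR (Variant a) x y ↔ greenR S x y := by
  refine ⟨greenR_of_variant, fun h => greenR_variant_def.2 ?_⟩
  have key : ∀ {x y : S}, greenR S (y * a) y → greenR S x y → ∃ s, x = y * a * s := by
    intro x y hy h
    obtain ⟨t, ht⟩ := (greenR_mul_iff hS).1 hy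
    obtain ⟨s, rfl⟩ := exists_mul_of_greenR hS h
    exact ⟨t * s, by rw [← mul_assoc, ← ht]⟩
  exact ⟨Or.inr (key hy h), Or.inr (key hx (Setoid.symm' _ h))⟩

theorem greenL_variant_iff (hS : ∀ x : S, ∃ e, x = e * x) (hx : greenL S (a * x) x)
    (hy : greenL S (a * y) y) : greenL (Variant a) x y ↔ greenL S x y := by
  refine ⟨greenL_of_variant, fun h => greenL_variant_def.2 ?_⟩
  have key : ∀ {x y : S}, greenL S (a * y) y → greenL S x y → ∃ s, x = s * a * y := by
    intro x y hy h
    obtain ⟨t, ht⟩ := (greenL_mul_iff hS).1 hy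
    obtain ⟨s, rfl⟩ := exists_mul_of_greenL hS h
    refine ⟨s * t, ?_⟩
    rw [mul_assoc s, mul_assoc s, ← ht]
  exact ⟨Or.inr (key hy h), Or.inr (key hx (Setoid.symm' _ h))⟩

/-- The equation y = tay survives right multiplication, so the left condition is constant on
R-classes. -/
theorem greenL_mul_of_greenR (hl : ∀ x : S, ∃ e, x = e * x) (hr : ∀ x : S, ∃ e, x = x * e)
    (h : greenR S x y) (hy : greenL S (a * y) y) : greenL S (a * x) x := by
  rw [greenL_mul_iff hl] at hy ⊢
  obtain ⟨t, ht⟩ := hy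
  obtain ⟨s, rfl⟩ := exists_mul_of_greenR hr h
  exact ⟨t, by rw [← mul_assoc, ← ht]⟩

theorem greenR_mul_of_greenL (hl : ∀ x : S, ∃ e, x = e * x) (hr : ∀ x : S, ∃ e, x = x * e)
    (h : greenL S x y) (hy : greenR S (y * a) y) : greenR S (x * a) x := by
  rw [greenR_mul_iff hr] at hy ⊢
  obtain ⟨t, ht⟩ := hy
  obtain ⟨s, rfl⟩ := exists_mul_of_greenL hl h
  refine ⟨t, ?_⟩
  rw [mul_assoc s, mul_assoc s, ← ht]

/-- If y = xas and x = yat, then y = ya(tas). The hypothesis on `x` serves the case y = x, where the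
relation gives no information. -/
theorem greenR_mul_of_greenR_variant (hr : ∀ x : S, ∃ e, x = x * e)
    (h : greenR (Variant a) y x) (hx : greenR S (x * a) x) : greenR S (y * a) y := by
  obtain ⟨h1, h2⟩ := greenR_variant_def.1 h
  rcases h1 with rfl | ⟨s, hs⟩
  · exact hx
  rcases h2 with rfl | ⟨t, ht⟩
  · exact hx
  rw [greenR_mul_iff hr]
  exact ⟨t * a * s, by rw [← mul_assoc, ← mul_assoc, ← ht, ← hs]⟩

theorem greenL_mul_of_greenL_variant (hl : ∀ x : S, ∃ e, x = e * x)
    (h : greenL (Variant a) y x) (hx : greenL S (a * x) x) : greenL S (a * y) y := by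
  obtain ⟨h1, h2⟩ := greenL_variant_def.1 h
  rcases h1 with rfl | ⟨s, hs⟩
  · exact hx
  rcases h2 with rfl | ⟨t, ht⟩
  · exact hx
  rw [greenL_mul_iff hl]
  refine ⟨s * a * t, ?_⟩
  rw [mul_assoc, mul_assoc, ← mul_assoc t, ← ht, ← hs]

theorem isRegularElt_variant (hl : ∀ x : S, ∃ e, x = e * x) (hr : ∀ x : S, ∃ e, x = x * e)
    (hx : x ∈ pSet a) {z : S} (hz : x = x * z * x) : IsRegularElt (S := Variant a) x := by
  obtain ⟨s, hs⟩ := (greenR_mul_iff hr).1 hx.1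
  obtain ⟨t, ht⟩ := (greenL_mul_iff hl).1 hx.2
  obtain ⟨u, h⟩ : ∃ u, x * (a * (u * (a * x))) = x := by
    refine ⟨s * z * t, ?_⟩
    calc x * (a * (s * z * t * (a * x))) = (x * a * s) * z * (t * a * x) := by
          simp only [mul_assoc]
      _ = x := by rw [← hs, ← ht, ← hz]
  have h' : ∀ w, x * (a * (u * (a * (x * w)))) = x * w := fun w => by
    conv_rhs => rw [← h]
    simp only [mul_assoc]
  -- In the variant `u` satisfies x = x ⋆ u ⋆ x only; u ⋆ x ⋆ u is then an inverse in both senses.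
  refine ⟨u * a * x * a * u, ?_, ?_⟩
  · change x = x * a * (u * a * x * a * u) * a * x
    simp only [mul_assoc, h', h]
  · change u * a * x * a * u = u * a * x * a * u * a * x * a * (u * a * x * a * u)
    simp only [mul_assoc, h']

end PSet

variable {n : ℕ}

theorem PB.exists_mul_right (ξ : PB n) : ∃ e, ξ = ξ * e := ⟨_, ξ.mul_star_mul_self.symm⟩

theorem PB.exists_mul_left (ξ : PB n) : ∃ e, ξ = e * ξ :=
  ⟨ξ * ξ.star, by rw [mul_assoc, ξ.mul_star_mul_self]⟩

theorem Linked.refl {T : Type*} (ε ε' : Setoid T) {X Y : Set T} (h : Y ⊆ X) :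
    Linked ε X ε' Y :=
  fun y hy => ⟨y, h hy, Setoid.refl' _ _⟩

theorem rank_eq_of_greenR {ξ σ : PB n} (h : greenR (PB n) ξ σ) : ξ.rank = σ.rank := by
  rw [PB.rank_eq_ncard_dom, PB.rank_eq_ncard_dom, (greenR_PB_iff.1 h).2]

theorem rank_eq_of_greenL {ξ σ : PB n} (h : greenL (PB n) ξ σ) : ξ.rank = σ.rank := by
  rw [PB.rank_eq_ncard_codom, PB.rank_eq_ncard_codom, (greenL_PB_iff.1 h).2]

theorem IsPBPair.subset {T : Type*} {ε : Setoid T} {X Y : Set T} (h : IsPBPair ε X)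
    (hY : Y ⊆ X) : IsPBPair ε Y :=
  ⟨h.1, fun x hx => h.2 x (hY hx)⟩

theorem exists_linked_of_le {ε : Setoid (Fin n)} {X : Set (Fin n)} (h : IsPBPair ε X) {q : ℕ}
    (hq : q ≤ X.ncard) : ∃ Y, IsPBPair ε Y ∧ Y.ncard = q ∧ Linked ε X ε Y := by
  obtain ⟨Y, hY, hYq⟩ := Set.exists_subset_card_eq hq
  exact ⟨Y, h.subset hY, hYq, Linked.refl _ _ hY⟩

theorem mem_regD_iff {α ξ : PB n} {q : ℕ} : ξ ∈ regD α q ↔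
    (Linked α.ker α.dom ξ.coker ξ.codom ∧ Linked α.coker α.codom ξ.ker ξ.dom) ∧ ξ.rank = q := by
  rw [← greenR_mul_PB_iff, ← greenL_mul_PB_iff]
  rfl

/-- The witness has kernel coker α and cokernel ker α, with q-element subsets of codom α and dom α
as its domain and codomain; each chosen point is linked to itself. -/
theorem regD_nonempty {α : PB n} {q : ℕ} (hq : q ≤ α.rank) : (regD α q).Nonempty := by
  obtain ⟨Y, hY, hYq, hYl⟩ := exists_linked_of_le α.isPBPair_ker (α.rank_eq_ncard_dom ▸ hq)
  obtain ⟨Z, hZ, hZq, hZl⟩ := exists_linked_of_le α.isPBPair_coker (α.rank_eq_ncard_codom ▸ hq)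
  obtain ⟨ξ, h1, h2, h3, h4⟩ := exists_PB hZ hY (hZq.trans hYq.symm)
  refine ⟨ξ, mem_regD_iff.2 ⟨⟨?_, ?_⟩, ?_⟩⟩
  · rwa [h3, h4]
  · rwa [h1, h2]
  · rw [ξ.rank_eq_ncard_dom, h2, hZq]

theorem isRegularDClass_regD {α : PB n} {q : ℕ} (hq : q ≤ α.rank) :
    IsRegularDClass (Variant α) (regD α q) := by
  have hl := PB.exists_mul_left (n := n)
  have hr := PB.exists_mul_right (n := n)
  refine ⟨?_, fun (ξ : PB n) hξ => isRegularElt_variant (S := PB n) hl hr hξ.1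
    (z := ξ.star) (ξ.mul_star_mul_self.symm.trans (mul_assoc _ _ _).symm)⟩
  obtain ⟨ξ, ⟨hξR, hξL⟩, hξq⟩ := regD_nonempty hq
  refine ⟨ξ, Set.ext fun σ => ⟨?_, ?_⟩⟩
  · rintro ⟨⟨hσR, hσL⟩, hσq⟩
    -- The intermediate element takes its upper pair from ξ and its lower pair from σ; equal ranks
    -- make this possible.
    obtain ⟨ζ, h1, h2, h3, h4⟩ := exists_PB ξ.isPBPair_ker σ.isPBPair_coker
      (by rw [← PB.rank_eq_ncard_dom, ← PB.rank_eq_ncard_codom, hξq, hσq])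
    have hζξ : greenR (PB n) ζ ξ := greenR_PB_iff.2 ⟨h1, h2⟩
    have hζσ : greenL (PB n) ζ σ := greenL_PB_iff.2 ⟨h3, h4⟩
    exact ⟨ζ, (greenR_variant_iff hr hξR (greenR_mul_of_greenL hl hr hζσ hσR)).2
        (Setoid.symm' _ hζξ),
      (greenL_variant_iff hl (greenL_mul_of_greenR hl hr hζξ hξL) hσL).2 hζσ⟩
  · rintro ⟨ζ, hζξ, hζσ⟩
    have hζξ' := greenR_of_variant (Setoid.symm' _ hζξ)
    have hσζ' := greenL_of_variant (Setoid.symm' _ hζσ)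
    -- For ζ the right condition travels along the variant relation and the left one along R of the
    -- monoid; for σ the roles are exchanged.
    have hζR := greenR_mul_of_greenR_variant hr (Setoid.symm' _ hζξ) hξR
    have hζL := greenL_mul_of_greenR hl hr hζξ' hξL
    exact ⟨⟨greenR_mul_of_greenL hl hr hσζ' hζR,
      greenL_mul_of_greenL_variant hl (Setoid.symm' _ hζσ) hζL⟩,
      (rank_eq_of_greenL hσζ').trans ((rank_eq_of_greenR hζξ').trans hξq)⟩

/-! ### Counting the classes -/

theorem numClasses_eq_ncard_image {S B : Type*} {r : Setoid S} {A : Set S} {f : S → B}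
    (h : ∀ x ∈ A, ∀ y ∈ A, r x y ↔ f x = f y) : numClasses r A = (f '' A).ncard := by
  have hker : Setoid.comap (Subtype.val : A → S) r = Setoid.ker fun x : A => f x :=
    Setoid.ext fun x y => h x x.2 y y.2
  rw [numClasses, hker, Nat.card_congr (Setoid.quotientKerEquivRange _), Set.image_eq_range]
  rfl

/-- The PB-pairs of size `q` that are linked to a given one. -/
def linkedPairs {T : Type*} (ε : Setoid T) (X : Set T) (q : ℕ) : Set (Setoid T × Set T) :=
  {p | IsPBPair p.1 p.2 ∧ p.2.ncard = q ∧ Linked ε X p.1 p.2}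

/-- An L-class is recorded by its lower pair. Every linked pair of size q occurs, since a
restriction of (coker α, codom α) to q points can serve as the upper pair. -/
theorem numClasses_greenL {α : PB n} {q : ℕ} (hq : q ≤ α.rank) :
    numClasses (greenL (Variant α)) (regD α q) = (linkedPairs α.ker α.dom q).ncard := by
  refine (numClasses_eq_ncard_image (S := Variant α)
    (f := fun ξ : PB n => (ξ.coker, ξ.codom)) ?_).trans ?_
  rotate_left
  · refine congrArg Set.ncard ?_
    ext ⟨η, X⟩
    constructor
    · rintro ⟨ξ, hξ, h⟩
      obtain ⟨rfl, rfl⟩ := Prod.mk.inj h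
      obtain ⟨⟨h1, -⟩, h2⟩ := mem_regD_iff.1 hξ
      exact ⟨PB.isPBPair_coker _, (PB.rank_eq_ncard_codom _).symm.trans h2, h1⟩
    · rintro ⟨h1, h2, h3⟩
      obtain ⟨Z, hZ, hZq, hZl⟩ := exists_linked_of_le α.isPBPair_coker
        (α.rank_eq_ncard_codom ▸ hq)
      obtain ⟨ξ, hk, rfl, rfl, rfl⟩ := exists_PB hZ h1 (hZq.trans h2.symm)
      exact ⟨ξ, mem_regD_iff.2 ⟨⟨h3, hk.symm ▸ hZl⟩, ξ.rank_eq_ncard_dom.trans hZq⟩, rfl⟩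
  · intro ξ hξ σ hσ
    exact ((greenL_variant_iff PB.exists_mul_left hξ.1.2 hσ.1.2).trans greenL_PB_iff).trans
      Prod.mk_inj.symm

theorem numClasses_greenR {α : PB n} {q : ℕ} (hq : q ≤ α.rank) :
    numClasses (greenR (Variant α)) (regD α q) = (linkedPairs α.coker α.codom q).ncard := by
  refine (numClasses_eq_ncard_image (S := Variant α)
    (f := fun ξ : PB n => (ξ.ker, ξ.dom)) ?_).trans ?_
  rotate_left
  · refine congrArg Set.ncard ?_
    ext ⟨η, X⟩
    constructor
    · rintro ⟨ξ, hξ, h⟩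
      obtain ⟨rfl, rfl⟩ := Prod.mk.inj h
      obtain ⟨⟨-, h1⟩, h2⟩ := mem_regD_iff.1 hξ
      exact ⟨PB.isPBPair_ker _, (PB.rank_eq_ncard_dom _).symm.trans h2, h1⟩
    · rintro ⟨h1, h2, h3⟩
      obtain ⟨Z, hZ, hZq, hZl⟩ := exists_linked_of_le α.isPBPair_ker
        (α.rank_eq_ncard_dom ▸ hq)
      obtain ⟨ξ, rfl, rfl, hk, rfl⟩ := exists_PB h1 hZ (h2.trans hZq.symm)
      exact ⟨ξ, mem_regD_iff.2 ⟨⟨hk.symm ▸ hZl, h3⟩, ξ.rank_eq_ncard_dom.trans h2⟩, rfl⟩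
  · intro ξ hξ σ hσ
    exact ((greenR_variant_iff PB.exists_mul_right hξ.1.1 hσ.1.1).trans greenR_PB_iff).trans
      Prod.mk_inj.symm

/-- An element of `X₂` is joined to at most one element of `X₁`. -/
theorem join_unique {T : Type*} {ε₁ ε₂ : Setoid T} {X₁ X₂ : Set T} (h₁ : IsPBPair ε₁ X₁)
    (h₂ : IsPBPair ε₂ X₂) {x x' y : T} (hx : x ∈ X₁) (hx' : x' ∈ X₁) (hy : y ∈ X₂)
    (h : (ε₁ ⊔ ε₂) x y) (h' : (ε₁ ⊔ ε₂) x' y) : x = x' := by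
  rw [isPBPair_iff] at h₁ h₂
  -- A point of X₁ ∩ X₂ is isolated in both equivalences, hence in their join.
  have hsingle : ∀ {u w}, u ∈ X₁ → u ∈ X₂ → (ε₁ ⊔ ε₂) u w → u = w := by
    intro u w hu1 hu2 hw
    let R : Setoid T :=
      { r := fun v w => v = u ↔ w = u
        iseqv := ⟨fun _ => Iff.rfl, Iff.symm, Iff.trans⟩ }
    have hR : ε₁ ⊔ ε₂ ≤ R := by
      refine sup_le (fun v w hvw => ⟨?_, ?_⟩) (fun v w hvw => ⟨?_, ?_⟩) <;> rintro rfl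
      · exact h₁.2 _ hu1 _ hvw
      · exact h₁.2 _ hu1 _ (ε₁.symm hvw)
      · exact h₂.2 _ hu2 _ hvw
      · exact h₂.2 _ hu2 _ (ε₂.symm hvw)
    exact ((hR hw).1 rfl).symm
  -- A class of the join contains at most two points of X₁ ∪ X₂, so two of `y`, `x`, `x'` coincide;
  -- if `y` is one of them, it is isolated.
  have hot := isOneTwo_iff.1 (isOneTwo_comap_sup h₁.1 h₂.1
    (o := (Subtype.val : (X₁ ∪ X₂ : Set T) → T)) Subtype.val_injective
    (fun t => t.2.imp (h₁.2 _) (h₂.2 _)))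
  rcases hot ⟨y, Or.inr hy⟩ ⟨x, Or.inl hx⟩ ⟨x', Or.inl hx'⟩ (Setoid.symm' _ h)
    (Setoid.symm' _ h') with e | e | e
  · cases congrArg Subtype.val e
    exact hsingle hx hy (Setoid.symm' _ h')
  · cases congrArg Subtype.val e
    exact (hsingle hx' hy (Setoid.symm' _ h)).symm
  · exact congrArg Subtype.val e

/-- By `join_unique` the pairs counted by the rank are determined by their second entries, so the
rank is the number of linked points of X₂. -/
theorem joinRank_eq_iff {T : Type*} [Finite T] {ε₁ ε₂ : Setoid T} {X₁ X₂ : Set T}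
    (h₁ : IsPBPair ε₁ X₁) (h₂ : IsPBPair ε₂ X₂) :
    joinRank ε₁ X₁ ε₂ X₂ = X₂.ncard ↔ Linked ε₁ X₁ ε₂ X₂ := by
  have himage : joinRank ε₁ X₁ ε₂ X₂ = {y ∈ X₂ | ∃ x ∈ X₁, (ε₁ ⊔ ε₂) x y}.ncard := by
    rw [joinRank, ← Set.InjOn.ncard_image (f := Prod.snd)]
    · congr 1
      ext y
      constructor
      · rintro ⟨⟨x, y⟩, ⟨hx, hy, h⟩, rfl⟩
        exact ⟨hy, x, hx, h⟩
      · rintro ⟨hy, x, hx, h⟩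
        exact ⟨(x, y), ⟨hx, hy, h⟩, rfl⟩
    · rintro ⟨x, y⟩ ⟨hx, hy, h⟩ ⟨x', y'⟩ ⟨hx', -, h'⟩ e
      cases (e : y = y')
      exact Prod.ext (join_unique h₁ h₂ hx hx' hy h h') rfl
  rw [himage]
  constructor
  · intro h y hy
    rw [← Set.eq_of_subset_of_ncard_le (Set.sep_subset _ _) h.ge (Set.toFinite _)] at hy
    exact hy.2
  · intro h
    congr 1
    exact Set.sep_eq_self_iff_mem_true.2 h

/-! ### Relabelling -/

/-- Along a bijection `s` is the image of its own pullback, which brings the claim under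
`comap_sup_map`. -/
theorem comap_sup_equiv {T T' : Type*} (e : T ≃ T') (r s : Setoid T') :
    (r ⊔ s).comap e = r.comap e ⊔ s.comap e := by
  have hs : (s.comap e).map e = s := by
    refine le_antisymm (map_le_iff.2 le_rfl) fun x y h => ?_
    have : (s.comap e).map e (e (e.symm x)) (e (e.symm y)) :=
      Setoid.le_comap_map (show s (e (e.symm x)) (e (e.symm y)) by simpa using h)
    simpa using this
  have h := comap_sup_map r (s.comap e) e
  rwa [hs] at h

theorem isPBPair_comap_equiv {T T' : Type*} (e : T ≃ T') {ε : Setoid T'} {X : Set T'}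
    (h : IsPBPair ε X) : IsPBPair (ε.comap e) (e ⁻¹' X) := by
  rw [isPBPair_iff, isOneTwo_iff] at h ⊢
  refine ⟨fun x y z hxy hxz => ?_, fun x hx y hxy => e.injective (h.2 _ hx _ hxy)⟩
  simpa only [e.injective.eq_iff] using h.1 _ _ _ hxy hxz

theorem Linked.comap_equiv {T T' : Type*} (e : T ≃ T') {ε ε' : Setoid T'} {X X' : Set T'}
    (h : Linked ε X ε' X') : Linked (ε.comap e) (e ⁻¹' X) (ε'.comap e) (e ⁻¹' X') := by
  intro y hy
  obtain ⟨x, hx, hxy⟩ := h _ hy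
  refine ⟨e.symm x, by simpa using hx, ?_⟩
  rw [← comap_sup_equiv, Setoid.comap_rel, e.apply_symm_apply]
  exact hxy

theorem comap_equiv_symm {T T' : Type*} (e : T ≃ T') (ε : Setoid T') :
    (ε.comap e).comap e.symm = ε :=
  Setoid.ext fun x y => by simp [Setoid.comap_rel]

theorem ncard_preimage_equiv {T T' : Type*} (e : T ≃ T') (Y : Set T') :
    (e ⁻¹' Y).ncard = Y.ncard :=
  Set.ncard_preimage_of_injective_subset_range e.injective (by simp)

theorem ncard_linkedPairs_comap_equiv {T T' : Type*} (e : T ≃ T')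
    (ε : Setoid T') (X : Set T') (q : ℕ) :
    (linkedPairs (ε.comap e) (e ⁻¹' X) q).ncard = (linkedPairs ε X q).ncard := by
  refine Set.ncard_congr (fun p _ => (p.1.comap e.symm, e.symm ⁻¹' p.2)) ?_ ?_ ?_
  · rintro ⟨η, Y⟩ ⟨h1, h2, h3⟩
    refine ⟨isPBPair_comap_equiv _ h1, (ncard_preimage_equiv _ _).trans h2, ?_⟩
    have := h3.comap_equiv e.symm
    rwa [comap_equiv_symm, Equiv.symm_preimage_preimage] at this
  · rintro ⟨η, Y⟩ ⟨η', Y'⟩ - - h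
    obtain ⟨h1, h2⟩ := Prod.mk.inj h
    refine Prod.ext ?_ (e.symm.surjective.preimage_injective h2)
    have := congrArg (Setoid.comap e) h1
    rwa [← e.symm_symm, comap_equiv_symm e.symm, comap_equiv_symm e.symm] at this
  · rintro ⟨η, Y⟩ ⟨h1, h2, h3⟩
    refine ⟨(η.comap e, e ⁻¹' Y), ⟨isPBPair_comap_equiv _ h1, (ncard_preimage_equiv _ _).trans h2,
      h3.comap_equiv e⟩, Prod.ext (comap_equiv_symm e η) (e.symm_preimage_preimage Y)⟩

end PartialBrauer
namespace PartialBrauer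

/-! ### Classification of PB-pairs -/

/-- The elements that form singleton classes. -/
def singletons {T : Type*} (ε : Setoid T) : Set T := {x | {x} ∈ ε.classes}

theorem numSingletons_eq {T : Type*} (ε : Setoid T) : numSingletons ε = (singletons ε).ncard := by
  have h : {C ∈ ε.classes | ∃ x, C = {x}} = (fun x => {x}) '' singletons ε := by
    ext C
    constructor
    · rintro ⟨hC, x, rfl⟩
      exact ⟨x, hC, rfl⟩
    · rintro ⟨x, hx, rfl⟩
      exact ⟨hx, x, rfl⟩
  rw [numSingletons, h, Set.ncard_image_of_injective _ Set.singleton_injective]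

theorem exists_equiv_of_card_fibers {Q Q' C : Type*} [Finite Q] [Finite Q'] {c : Q → C}
    {c' : Q' → C} (h : ∀ i, Nat.card {x // c x = i} = Nat.card {x // c' x = i}) :
    ∃ e : Q ≃ Q', ∀ x, c' (e x) = c x := by
  have g : ∀ i, {x // c x = i} ≃ {x // c' x = i} := fun i => (Finite.card_eq.1 (h i)).some
  refine ⟨((Equiv.sigmaFiberEquiv c).symm.trans (Equiv.sigmaCongrRight g)).trans
    (Equiv.sigmaFiberEquiv c'), fun x => ?_⟩
  exact (g (c x) ⟨x, rfl⟩).2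

/-- Colour each point by its membership in `X` and `S`. Nesting leaves only X, S \ X and the
complement of S, whose sizes are fixed by the three cardinalities. -/
theorem exists_equiv_of_nested {Q Q' : Type*} [Finite Q] [Finite Q'] {X S : Set Q}
    {X' S' : Set Q'} (hXS : X ⊆ S) (hXS' : X' ⊆ S') (hX : X.ncard = X'.ncard)
    (hS : S.ncard = S'.ncard) (hQ : Nat.card Q = Nat.card Q') :
    ∃ e : Q ≃ Q', ∀ x, (e x ∈ X' ↔ x ∈ X) ∧ (e x ∈ S' ↔ x ∈ S) := by
  have hfib : ∀ i : Prop × Prop,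
      Nat.card {x // (x ∈ X, x ∈ S) = i} = Nat.card {x // (x ∈ X', x ∈ S') = i} := by
    rintro ⟨p, r⟩
    change {x | ((x ∈ X, x ∈ S) : Prop × Prop) = (p, r)}.ncard =
      {x | ((x ∈ X', x ∈ S') : Prop × Prop) = (p, r)}.ncard
    simp only [Prod.mk.injEq, eq_iff_iff]
    by_cases hp : p <;> by_cases hr : r <;> simp only [hp, hr, iff_true, iff_false]
    · rwa [show {x | x ∈ X ∧ x ∈ S} = X from Set.inter_eq_left.2 hXS,
        show {x | x ∈ X' ∧ x ∈ S'} = X' from Set.inter_eq_left.2 hXS']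
    · rw [show {x | x ∈ X ∧ x ∉ S} = ∅ from Set.sdiff_eq_empty.2 hXS,
        show {x | x ∈ X' ∧ x ∉ S'} = ∅ from Set.sdiff_eq_empty.2 hXS', Set.ncard_empty,
        Set.ncard_empty]
    · rw [show {x | x ∉ X ∧ x ∈ S} = S \ X from Set.ext fun x => and_comm,
        show {x | x ∉ X' ∧ x ∈ S'} = S' \ X' from Set.ext fun x => and_comm,
        Set.ncard_sdiff hXS, Set.ncard_sdiff hXS', hX, hS]
    · rw [show {x | x ∉ X ∧ x ∉ S} = Sᶜ from
          Set.ext fun x => ⟨fun h => h.2, fun h => ⟨fun h' => h (hXS h'), h⟩⟩,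
        show {x | x ∉ X' ∧ x ∉ S'} = S'ᶜ from
          Set.ext fun x => ⟨fun h => h.2, fun h => ⟨fun h' => h (hXS' h'), h⟩⟩,
        Set.ncard_compl, Set.ncard_compl, hS, hQ]
  obtain ⟨e, he⟩ := exists_equiv_of_card_fibers hfib
  exact ⟨e, fun x => ⟨(Prod.mk.inj (he x)).1.to_iff, (Prod.mk.inj (he x)).2.to_iff⟩⟩

section Classification

variable {T : Type*} {ε : Setoid T}

theorem mem_image_mk_iff {X : Set T} (hX : X ⊆ singletons ε) {x : T} :
    Quotient.mk ε x ∈ Quotient.mk ε '' X ↔ x ∈ X := by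
  refine ⟨?_, fun h => ⟨x, h, rfl⟩⟩
  rintro ⟨y, hy, h⟩
  rwa [singleton_mem_classes.1 (hX hy) x (Quotient.exact h)]

theorem ncard_image_mk {X : Set T} (hX : X ⊆ singletons ε) :
    (Quotient.mk ε '' X).ncard = X.ncard := by
  refine Set.InjOn.ncard_image fun x hx y _ h => ?_
  exact (singleton_mem_classes.1 (hX hx) y (Quotient.exact h)).symm

open Classical in
theorem card_fiber_mk (hε : IsOneTwo ε) (x : T) :
    Nat.card {y // Quotient.mk ε y = Quotient.mk ε x} = if x ∈ singletons ε then 1 else 2 := by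
  change {y | Quotient.mk ε y = Quotient.mk ε x}.ncard = _
  have hfib : {y | Quotient.mk ε y = Quotient.mk ε x} = {y | ε y x} :=
    Set.ext fun y => Quotient.eq
  rw [hfib]
  split_ifs with h
  · rw [Set.ncard_eq_one]
    exact ⟨x, Set.ext fun y =>
      ⟨fun hy => singleton_mem_classes.1 h y (ε.symm hy), fun hy => hy ▸ ε.refl _⟩⟩
  · have h' : ∃ y, ε x y ∧ y ≠ x := by
      by_contra! hne
      exact h (singleton_mem_classes.2 hne)
    obtain ⟨y, hxy, hne⟩ := h'
    rw [Set.ncard_eq_two]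
    refine ⟨x, y, hne.symm, Set.ext fun z => ⟨fun hz => ?_, ?_⟩⟩
    · rcases isOneTwo_iff.1 hε x y z hxy (ε.symm hz) with e | e | e
      · exact absurd e.symm hne
      · exact Or.inl e.symm
      · exact Or.inr e.symm
    · rintro (rfl | rfl)
      · exact ε.refl _
      · exact ε.symm hxy

/-- The size of a class, increased by 1 if it is a singleton, is always 2. Summing over classes
determines their number and gives the parity condition in `mu`. -/
theorem card_eq_ncard_singletons_add [Finite T] (hε : IsOneTwo ε) :
    Nat.card T + (singletons ε).ncard = 2 * Nat.card (Quotient ε) := by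
  classical
  have := Fintype.ofFinite T
  have := Fintype.ofFinite (Quotient ε)
  have h1 : Nat.card T = ∑ c : Quotient ε, Nat.card {x // Quotient.mk ε x = c} := by
    rw [← Nat.card_sigma]
    exact Nat.card_congr (Equiv.sigmaFiberEquiv _).symm
  have h2 : ∀ c : Quotient ε, Nat.card {x // Quotient.mk ε x = c} +
      (if c ∈ Quotient.mk ε '' singletons ε then 1 else 0) = 2 := by
    intro c
    induction c using Quotient.inductionOn with | _ x
    rw [card_fiber_mk hε, mem_image_mk_iff subset_rfl]
    split_ifs <;> rfl
  have h3 := Finset.sum_congr (rfl : Finset.univ = Finset.univ) fun c _ => h2 c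
  rw [Finset.sum_add_distrib, ← h1, Finset.sum_boole, Finset.sum_const, Finset.card_univ] at h3
  rw [← ncard_image_mk (ε := ε) subset_rfl, Set.ncard_eq_toFinset_card', Nat.card_eq_fintype_card
    (α := Quotient ε), ← smul_eq_mul, smul_eq_mul, mul_comm, ← smul_eq_mul, ← h3]
  congr 1
  simp only [Nat.cast_id]
  congr 1
  ext c
  simp

/-- Up to relabelling, a PB-pair is determined by the number of its vertices, the number of its
singleton classes and the number of the distinguished ones. -/
theorem IsPBPair.exists_equiv {T' : Type*} [Finite T] [Finite T'] {ε' : Setoid T'} {X : Set T} {X' : Set T'}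
    (h : IsPBPair ε X) (h' : IsPBPair ε' X') (hX : X.ncard = X'.ncard)
    (hS : (singletons ε).ncard = (singletons ε').ncard) (hT : Nat.card T = Nat.card T') :
    ∃ e : T ≃ T', ε'.comap e = ε ∧ e ⁻¹' X' = X := by
  have hQ : Nat.card (Quotient ε) = Nat.card (Quotient ε') := by
    have h1 := card_eq_ncard_singletons_add h.1
    have h2 := card_eq_ncard_singletons_add h'.1
    omega
  have hXs : X ⊆ singletons ε := h.2
  have hXs' : X' ⊆ singletons ε' := h'.2
  -- Classes are matched before points: `f` respects distinguished and singleton classes, so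
  -- corresponding classes have equal size and `f` lifts to `e`.
  obtain ⟨f, hf⟩ := exists_equiv_of_nested (Set.image_mono (f := Quotient.mk ε) hXs)
    (Set.image_mono (f := Quotient.mk ε') hXs')
    (by rw [ncard_image_mk h.2, ncard_image_mk h'.2, hX])
    (by rw [ncard_image_mk subset_rfl, ncard_image_mk subset_rfl, hS]) hQ
  obtain ⟨e, he⟩ := exists_equiv_of_card_fibers (c := fun x => f (Quotient.mk ε x))
    (c' := Quotient.mk ε') (by
      intro c
      obtain ⟨c, rfl⟩ := f.surjective c
      induction c using Quotient.inductionOn with | _ x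
      obtain ⟨x', hx'⟩ := Quotient.exists_rep (f (Quotient.mk ε x))
      have h1 := (hf (Quotient.mk ε x)).2
      rw [← hx', mem_image_mk_iff subset_rfl, mem_image_mk_iff subset_rfl] at h1
      have h2 : ∀ y, f (Quotient.mk ε y) = f (Quotient.mk ε x) ↔
          Quotient.mk ε y = Quotient.mk ε x := fun y => f.injective.eq_iff
      rw [Nat.card_congr (Equiv.subtypeEquivRight h2), ← hx', card_fiber_mk h.1,
        card_fiber_mk h'.1]
      by_cases hx : x ∈ singletons ε
      · rw [if_pos hx, if_pos (h1.2 hx)]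
      · rw [if_neg hx, if_neg (mt h1.1 hx)])
  refine ⟨e, Setoid.ext fun x y => ?_, Set.ext fun x => ?_⟩
  · rw [Setoid.comap_rel, ← Quotient.eq (r := ε'), he, he, f.injective.eq_iff]
    exact Quotient.eq
  · rw [Set.mem_preimage, ← mem_image_mk_iff h'.2, he, (hf _).1, mem_image_mk_iff h.2]

end Classification

/-! ### The standard PB-pairs -/

theorem ncard_initialSeg {m t : ℕ} (h : t ≤ m) : (initialSeg m t).ncard = t := by
  have : initialSeg m t = Set.range (Fin.castLE h) := by
    ext i
    constructor
    · exact fun hi => ⟨⟨i, hi⟩, rfl⟩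
    · rintro ⟨j, rfl⟩
      exact j.2
  rw [this, Set.ncard_range_of_injective (Fin.castLE_injective h), Nat.card_fin]

theorem stdEquiv_iff {m k : ℕ} {i j : Fin m} : stdEquiv m k i j ↔
    (if (i : ℕ) < k then (i : ℕ) else k + ((i : ℕ) - k) / 2) =
      if (j : ℕ) < k then (j : ℕ) else k + ((j : ℕ) - k) / 2 :=
  Iff.rfl

theorem isOneTwo_stdEquiv (m k : ℕ) : IsOneTwo (stdEquiv m k) := by
  refine isOneTwo_iff.2 fun x y z hxy hxz => ?_
  rw [stdEquiv_iff] at hxy hxz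
  simp only [Fin.ext_iff]
  split_ifs at hxy hxz <;> omega

theorem singletons_stdEquiv {m k : ℕ} (h : k ≡ m [MOD 2]) :
    singletons (stdEquiv m k) = initialSeg m k := by
  ext i
  rw [singletons, Set.mem_ofPred_eq, singleton_mem_classes]
  change _ ↔ (i : ℕ) < k
  have hi := i.2
  unfold Nat.ModEq at h
  constructor
  · intro hs
    by_contra hik
    -- Beyond `k`, the partner of `i` is `i + 1` or `i - 1` according to the parity of `i - k`; k ≡
    -- m keeps `i + 1` below `m`.
    by_cases hpar : ((i : ℕ) - k) % 2 = 0
    · have := hs ⟨i + 1, by omega⟩ (by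
        rw [stdEquiv_iff]
        simp only
        split_ifs <;> omega)
      simp [Fin.ext_iff] at this
    · have := hs ⟨i - 1, by omega⟩ (by
        rw [stdEquiv_iff]
        simp only
        split_ifs <;> omega)
      simp only [Fin.ext_iff] at this
      omega
  · intro hik j hij
    rw [stdEquiv_iff] at hij
    rw [Fin.ext_iff]
    split_ifs at hij <;> omega

theorem mu_eq_ncard_linkedPairs {n : ℕ} {ε : Setoid (Fin n)} {X : Set (Fin n)}
    (h : IsPBPair ε X) (q : ℕ) :
    mu n (numSingletons ε) X.ncard q = (linkedPairs ε X q).ncard := by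
  rw [numSingletons_eq]
  have hsum := card_eq_ncard_singletons_add h.1
  have hkn : (singletons ε).ncard ≤ n :=
    (Set.ncard_le_card _).trans_eq (Nat.card_fin n)
  have htk : X.ncard ≤ (singletons ε).ncard := Set.ncard_le_ncard h.2
  rw [Nat.card_fin] at hsum
  have hmod : (singletons ε).ncard ≡ n [MOD 2] := by
    unfold Nat.ModEq
    omega
  have hS := singletons_stdEquiv hmod
  have hstd : IsPBPair (stdEquiv n (singletons ε).ncard) (initialSeg n X.ncard) := by
    refine ⟨isOneTwo_stdEquiv _ _, fun i hi => ?_⟩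
    have : i ∈ singletons (stdEquiv n (singletons ε).ncard) := by
      rw [hS]
      exact lt_of_lt_of_le hi htk
    exact this
  obtain ⟨e, he, heX⟩ := h.exists_equiv hstd (ncard_initialSeg (htk.trans hkn)).symm
    (by rw [hS, ncard_initialSeg hkn]) rfl
  -- Parameters coming from an actual PB-pair never reach the default value 0.
  rw [mu, if_pos ⟨hkn, hmod, htk.trans hkn, hstd⟩]
  have key := ncard_linkedPairs_comap_equiv e (stdEquiv n (singletons ε).ncard)
    (initialSeg n X.ncard) q
  rw [he, heX] at key
  rw [key]
  refine congrArg Set.ncard (Set.ext fun p => ?_)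
  refine and_congr_right fun hp => and_congr_right fun hpq => ?_
  -- As |X| = q for the counted pair, rank q is full rank, that is, linkedness.
  rw [← joinRank_eq_iff hstd hp, hpq]

end PartialBrauer

open PartialBrauer in
theorem lemmal (n : ℕ) (α : PB n) (q : ℕ) (hq : q ≤ α.rank) :
    IsRegularDClass (Variant α) (regD α q) ∧
    numClasses (greenL (Variant α)) (regD α q) = mu n (numSingletons α.ker) α.rank q ∧
    numClasses (greenR (Variant α)) (regD α q) = mu n (numSingletons α.coker) α.rank q := by
  refine ⟨isRegularDClass_regD hq, ?_, ?_⟩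
  · rw [numClasses_greenL hq, α.rank_eq_ncard_dom, mu_eq_ncard_linkedPairs α.isPBPair_ker]
  · rw [numClasses_greenR hq, α.rank_eq_ncard_codom, mu_eq_ncard_linkedPairs α.isPBPair_coker]
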